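/- **Setting.** Let $\mathcal M$ be a set of probability measures on a measurable space $\mathcal Z$ (the semiparametric model), $P_0\in\mathcal M$, and for each $n$ let $Z_1,\dots,Z_n$ be i.i.d. from $P_0$; $E$ and $\mathrm{Var}$ refer to $P_0$ and $Z\sim P_0$. A *regular parametric submodel* is a family $\{P_\eta:\eta\in\Theta\}\subseteq\mathcal M$, $\Theta\subseteq\mathbb R^k$ open, with $P_{\eta_0}=P_0$ for some $\eta_0\in\Theta$, dominated by a $\sigma$-finite measure $\mu$, whose square-root density $\eta\mapsto f_\eta^{1/2}\in L^2(\mu)$ is continuously Fréchet differentiable with nonsingular Fisher information matrix at every $\eta\in\Theta$; its score vector at $\eta_0$ is $S=2\,\nabla_\eta f_{\eta_0}^{1/2}/f_{\eta_0}^{1/2}$, and $I=E[SS']$. The *tangent set* $\mathcal T\subseteq L^2(P_0)$ is the mean-square closure of the set of all scores $a'S$ ($a\in\mathbb R^k$) of regular parametric submodels. A parameter $\beta:\mathcal M\to\mathbb R$ is *differentiable* (at $P_0$) if there is $d\in L^2(P_0)$ such that, for every regular parametric submodel, $\eta\mapsto\beta(P_\eta)$ is differentiable at $\eta_0$ with gradient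 $E[d(Z)S]$; any such $d$ is called a *gradient* of $\beta$. An *efficient influence function* of $\beta$ is a gradient of $\beta$ that belongs to $\mathcal T$. An estimator (a measurable function of $Z_1,\dots,Z_n$ for each $n$) $\hat\beta$ is *asymptotically linear with influence function* $\phi$ if $E[\phi(Z)]=0$, $E[\phi(Z)^2]<\infty$ and $\sqrt n(\hat\beta-\beta(P_0))=n^{-1/2}\sum_{i=1}^n\phi(Z_i)+o_p(1)$. It is *semiparametrically efficient* if the supremum $V$ over all regular parametric submodels of the Cramér–Rao bounds $g'I^{-1}g$, $g=\nabla_\eta\beta(P_{\eta})|_{\eta=\eta_0}$, is finite and, in every regular parametric submodel and for every sequence $\eta_n\in\Theta$ with $\sqrt n(\eta_n-\eta_0)$ bounded, $\sqrt n(\hat\beta-\beta(P_{\eta_n}))$ converges in distribution to $N(0,V)$ when the data are i.i.d. from $P_{\eta_n}$. **Theorem 1.** Assume that $\mathcal T$ is a linear subspace of $L^2(P_0)$, that $\theta$ and $b$ are differentiable parameters, with $\theta_0=\theta(P_0)$ and $b_0=b(P_0)$, and that $\hat\theta$ is an asymptotically linear (with influence function $\psi$) and semiparametrically efficient estimator of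 $\theta$ with the expansion $$\sqrt n(\hat\theta-\theta_0)=A_1+\frac{A_2}{\sqrt n}+\frac{A_3}{n}+o_p(n^{-1}),\qquad A_1=\frac1{\sqrt n}\sum_{i=1}^n\psi(Z_i),$$ where $A_1,A_2,A_3$ are functions of $Z_1,\dots,Z_n$ bounded in probability and, for every $n\ge1$, $E[A_2^2]<\infty$, $E|A_1A_3|<\infty$ and $E[A_2]=b_0$. Put $\upsilon=\mathrm{Var}(A_2)+2\sqrt n\,E[A_1A_2]+2E[A_1A_3]$. Then $b$ has an efficient influence function $\delta$, unique in $L^2(P_0)$. Let $\hat b$ be any asymptotically linear estimator of $b$ whose influence function $d$ is a gradient of $b$. Then: 1. $\tilde\theta=\hat\theta-\hat b/n$ satisfies $\sqrt n(\tilde\theta-\theta_0)=A_1+\tilde A_2/\sqrt n+\tilde A_3/n+o_p(n^{-1})$ with $\tilde A_2=A_2-b_0$ and $\tilde A_3=A_3-n^{-1/2}\sum_{i=1}^n d(Z_i)$, all terms bounded in probability; 2. $E[\psi(Z)d(Z)]=E[\psi(Z)\delta(Z)]$; 3. for every $n\ge1$ the higher-order variance $\tilde\upsilon=\mathrm{Var}(\tilde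 A_2)+2\sqrt n\,E[A_1\tilde A_2]+2E[A_1\tilde A_3]$ of $\tilde\theta$ equals $\upsilon-2E[\psi(Z)\delta(Z)]$. In particular, $\tilde\upsilon$ is the same for all such $\hat b$: it does not depend on which $\hat b$ is used. -/

import Mathlib

open MeasureTheory ProbabilityTheory Filter Topology
open scoped NNReal ENNReal

namespace SemiparametricBias

noncomputable section

/-! ### Samples, stochastic orders, asymptotic linearity -/

/-- The law of an i.i.d. sample of size `n` from `P`. -/
abbrev iid {𝒵 : Type*} [MeasurableSpace 𝒵] (P : ProbabilityMeasure 𝒵) (n : ℕ) :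
    Measure (Fin n → 𝒵) :=
  Measure.pi fun _ : Fin n => (P : Measure 𝒵)

/-- `X n = o_p(1)` when the sample of size `n` is i.i.d. from `P`. -/
def IsLittleOInProb {𝒵 : Type*} [MeasurableSpace 𝒵] (P : ProbabilityMeasure 𝒵)
    (X : (n : ℕ) → (Fin n → 𝒵) → ℝ) : Prop :=
  ∀ ε : ℝ, 0 < ε → Tendsto (fun n => iid P n {z | ε ≤ |X n z|}) atTop (𝓝 0)

/-- `X n = O_p(1)` when the sample of size `n` is i.i.d. from `P`. -/
def IsBoundedInProb {𝒵 : Type*} [MeasurableSpace 𝒵] (P : ProbabilityMeasure 𝒵)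
    (X : (n : ℕ) → (Fin n → 𝒵) → ℝ) : Prop :=
  ∀ ε : ℝ≥0∞, 0 < ε → ∃ C : ℝ, ∀ᶠ n in atTop, iid P n {z | C < |X n z|} ≤ ε

/-- The normalized sum `n^{-1/2} ∑ᵢ φ(Zᵢ)`. -/
def normalizedSum {𝒵 : Type*} (φ : 𝒵 → ℝ) (n : ℕ) (z : Fin n → 𝒵) : ℝ :=
  (√(n : ℝ))⁻¹ * ∑ i, φ (z i)

/-- The estimator `est` of the number `v` is asymptotically linear at `P` with influence
function `φ`. -/
structure IsAsymptoticallyLinear {𝒵 : Type*} [MeasurableSpace 𝒵] (P : ProbabilityMeasure 𝒵)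
    (est : (n : ℕ) → (Fin n → 𝒵) → ℝ) (v : ℝ) (φ : 𝒵 → ℝ) : Prop where
  memLp : MemLp φ 2 (P : Measure 𝒵)
  mean_zero : ∫ z, φ z ∂(P : Measure 𝒵) = 0
  expansion : IsLittleOInProb P fun n z => √(n : ℝ) * (est n z - v) - normalizedSum φ n z

/-! ### Regular parametric submodels, tangent set, differentiable parameters -/

/-- A regular parametric submodel, through `P₀`, of the model `𝓜`: a finite-dimensional family
`η ↦ law η ∈ 𝓜`, `η ∈ Θ` open, dominated by a σ-finite measure `μ`, whose square-root density
`η ↦ root η` is continuously (Fréchet) differentiable as a map into `L²(μ)`, with everywhere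
nonsingular Fisher information matrix `4 ∫ ∂ᵢ√f ∂ⱼ√f dμ`. -/
structure RegularSubmodel {𝒵 : Type*} [MeasurableSpace 𝒵] (𝓜 : Set (ProbabilityMeasure 𝒵))
    (P₀ : ProbabilityMeasure 𝒵) where
  dim : ℕ
  Θ : Set (EuclideanSpace ℝ (Fin dim))
  isOpen : IsOpen Θ
  η₀ : EuclideanSpace ℝ (Fin dim)
  η₀_mem : η₀ ∈ Θ
  law : EuclideanSpace ℝ (Fin dim) → ProbabilityMeasure 𝒵
  law_mem : ∀ η ∈ Θ, law η ∈ 𝓜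
  law_η₀ : law η₀ = P₀
  μ : Measure 𝒵
  sigmaFinite : SigmaFinite μ
  root : EuclideanSpace ℝ (Fin dim) → Lp ℝ 2 μ
  root_nonneg : ∀ η ∈ Θ, 0 ≤ root η
  law_eq : ∀ η ∈ Θ,
    (law η : Measure 𝒵) = μ.withDensity fun z => ENNReal.ofReal ((root η : 𝒵 → ℝ) z ^ 2)
  contDiffOn : ContDiffOn ℝ 1 root Θ
  information_nonsingular : ∀ η ∈ Θ,
    (Matrix.of fun i j : Fin dim =>
      4 * inner ℝ (fderiv ℝ root η (EuclideanSpace.single i 1))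
        (fderiv ℝ root η (EuclideanSpace.single j 1))).det ≠ 0

namespace RegularSubmodel

variable {𝒵 : Type*} [MeasurableSpace 𝒵] {𝓜 : Set (ProbabilityMeasure 𝒵)}
  {P₀ : ProbabilityMeasure 𝒵}

/-- Fisher information matrix at the true value. -/
def information (M : RegularSubmodel 𝓜 P₀) : Matrix (Fin M.dim) (Fin M.dim) ℝ :=
  Matrix.of fun i j : Fin M.dim =>
    4 * inner ℝ (fderiv ℝ M.root M.η₀ (EuclideanSpace.single i 1))
      (fderiv ℝ M.root M.η₀ (EuclideanSpace.single j 1))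

/-- The score at the true value in the direction `a`, that is `aᵀ S` with `S` the score vector
(derivative of the log-density, computed from the derivative of the root density). -/
def score (M : RegularSubmodel 𝓜 P₀) (a : EuclideanSpace ℝ (Fin M.dim)) (z : 𝒵) : ℝ :=
  2 * (fderiv ℝ M.root M.η₀ a : 𝒵 → ℝ) z / (M.root M.η₀ : 𝒵 → ℝ) z

/-- The gradient at the true value of the parameter `β` along the submodel. -/
def paramGradient (M : RegularSubmodel 𝓜 P₀) (β : ProbabilityMeasure 𝒵 → ℝ) :
    Fin M.dim → ℝ :=
  fun j => fderiv ℝ (fun η => β (M.law η)) M.η₀ (EuclideanSpace.single j 1)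

/-- The Cramér–Rao bound `gᵀ I⁻¹ g` for the parameter `β` in the submodel. -/
def cramerRaoBound (M : RegularSubmodel 𝓜 P₀) (β : ProbabilityMeasure 𝒵 → ℝ) : ℝ :=
  M.paramGradient β ⬝ᵥ (M.information⁻¹).mulVec (M.paramGradient β)

end RegularSubmodel

/-- The tangent set: the mean-square closure of the set of all scores of regular parametric
submodels. -/
def tangentSet {𝒵 : Type*} [MeasurableSpace 𝒵] (𝓜 : Set (ProbabilityMeasure 𝒵))
    (P₀ : ProbabilityMeasure 𝒵) : Set (Lp ℝ 2 (P₀ : Measure 𝒵)) :=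
  closure {t | ∃ (M : RegularSubmodel 𝓜 P₀) (a : EuclideanSpace ℝ (Fin M.dim)),
    (t : 𝒵 → ℝ) =ᵐ[(P₀ : Measure 𝒵)] M.score a}

/-- The tangent set is linear, i.e. a linear subspace of `L²(P₀)`. -/
def TangentSetIsLinear {𝒵 : Type*} [MeasurableSpace 𝒵] (𝓜 : Set (ProbabilityMeasure 𝒵))
    (P₀ : ProbabilityMeasure 𝒵) : Prop :=
  ∃ K : Submodule ℝ (Lp ℝ 2 (P₀ : Measure 𝒵)), (K : Set _) = tangentSet 𝓜 P₀

/-- `d` is square integrable and represents the derivative of the parameter `β` at `P₀`: along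
every regular parametric submodel the derivative of `β` exists and is `E[d S]`. -/
def IsGradient {𝒵 : Type*} [MeasurableSpace 𝒵] (𝓜 : Set (ProbabilityMeasure 𝒵))
    (P₀ : ProbabilityMeasure 𝒵) (β : ProbabilityMeasure 𝒵 → ℝ) (d : 𝒵 → ℝ) : Prop :=
  MemLp d 2 (P₀ : Measure 𝒵) ∧
    ∀ M : RegularSubmodel 𝓜 P₀,
      DifferentiableAt ℝ (fun η => β (M.law η)) M.η₀ ∧
        ∀ a, fderiv ℝ (fun η => β (M.law η)) M.η₀ a
          = ∫ z, d z * M.score a z ∂(P₀ : Measure 𝒵)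

/-- The parameter `β` is differentiable at `P₀` relative to the model `𝓜`. -/
def IsDifferentiableParameter {𝒵 : Type*} [MeasurableSpace 𝒵]
    (𝓜 : Set (ProbabilityMeasure 𝒵)) (P₀ : ProbabilityMeasure 𝒵)
    (β : ProbabilityMeasure 𝒵 → ℝ) : Prop :=
  ∃ d : 𝒵 → ℝ, IsGradient 𝓜 P₀ β d

/-- `δ` is an efficient influence function of `β`: a representer of its derivative that lies in
the tangent set. -/
def IsEfficientInfluenceFunction {𝒵 : Type*} [MeasurableSpace 𝒵]
    (𝓜 : Set (ProbabilityMeasure 𝒵)) (P₀ : ProbabilityMeasure 𝒵)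
    (β : ProbabilityMeasure 𝒵 → ℝ) (δ : Lp ℝ 2 (P₀ : Measure 𝒵)) : Prop :=
  δ ∈ tangentSet 𝓜 P₀ ∧ IsGradient 𝓜 P₀ β δ

/-! ### Regular and efficient estimators -/

/-- A local data generating process in the submodel `M`: a sequence of parameter values `η n`,
one for each sample size, with `√n (η n - η₀)` bounded. -/
def IsLocalSequence {𝒵 : Type*} [MeasurableSpace 𝒵] {𝓜 : Set (ProbabilityMeasure 𝒵)}
    {P₀ : ProbabilityMeasure 𝒵} (M : RegularSubmodel 𝓜 P₀)
    (η : ℕ → EuclideanSpace ℝ (Fin M.dim)) : Prop :=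
  (∀ n, η n ∈ M.Θ) ∧ ∃ C : ℝ, ∀ n : ℕ, √(n : ℝ) * ‖η n - M.η₀‖ ≤ C

/-- The estimator `est` of the parameter `β` is regular with limiting distribution `L`: along
every local data generating process in every regular parametric submodel,
`√n (est n - β(law (η n)))` converges in distribution to `L`. -/
def IsRegularWithLimit {𝒵 : Type*} [MeasurableSpace 𝒵] (𝓜 : Set (ProbabilityMeasure 𝒵))
    (P₀ : ProbabilityMeasure 𝒵) (β : ProbabilityMeasure 𝒵 → ℝ)
    (est : (n : ℕ) → (Fin n → 𝒵) → ℝ) (L : Measure ℝ) [IsProbabilityMeasure L] : Prop :=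
  ∀ (M : RegularSubmodel 𝓜 P₀) (η : ℕ → EuclideanSpace ℝ (Fin M.dim)), IsLocalSequence M η →
    TendstoInDistribution (fun (n : ℕ) (z : Fin n → 𝒵) => √(n : ℝ) * (est n z - β (M.law (η n))))
      atTop (id : ℝ → ℝ) (fun n => iid (M.law (η n)) n) L

/-- `V` is the semiparametric efficiency bound for `β` at `P₀`: the supremum of the Cramér–Rao
bounds of the regular parametric submodels. -/
def IsEfficiencyBound {𝒵 : Type*} [MeasurableSpace 𝒵] (𝓜 : Set (ProbabilityMeasure 𝒵))
    (P₀ : ProbabilityMeasure 𝒵) (β : ProbabilityMeasure 𝒵 → ℝ) (V : ℝ) : Prop :=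
  IsLUB (Set.range fun M : RegularSubmodel 𝓜 P₀ => M.cramerRaoBound β) V

/-- The estimator `est` of `β` is semiparametrically efficient at `P₀`: it is regular and
asymptotically normal, with asymptotic variance equal to the semiparametric efficiency bound. -/
def IsSemiparametricallyEfficient {𝒵 : Type*} [MeasurableSpace 𝒵]
    (𝓜 : Set (ProbabilityMeasure 𝒵)) (P₀ : ProbabilityMeasure 𝒵)
    (β : ProbabilityMeasure 𝒵 → ℝ) (est : (n : ℕ) → (Fin n → 𝒵) → ℝ) : Prop :=
  ∃ V : ℝ≥0, IsEfficiencyBound 𝓜 P₀ β V ∧ IsRegularWithLimit 𝓜 P₀ β est (gaussianReal 0 V)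

/-! ### Third-order expansions and the higher-order variance -/

/-- The stochastic expansion `√n (est - v) = A₁ + A₂ / √n + A₃ / n + o_p(1/n)` with terms bounded
in probability. -/
structure HasThirdOrderExpansion {𝒵 : Type*} [MeasurableSpace 𝒵] (P : ProbabilityMeasure 𝒵)
    (est : (n : ℕ) → (Fin n → 𝒵) → ℝ) (v : ℝ) (A₁ A₂ A₃ : (n : ℕ) → (Fin n → 𝒵) → ℝ) : Prop where
  bounded₁ : IsBoundedInProb P A₁
  bounded₂ : IsBoundedInProb P A₂
  bounded₃ : IsBoundedInProb P A₃
  expansion : IsLittleOInProb P fun n z =>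
    (n : ℝ) * (√(n : ℝ) * (est n z - v) - (A₁ n z + A₂ n z / √(n : ℝ) + A₃ n z / (n : ℝ)))

/-- The higher-order variance `Var(A₂) + 2 √n E[A₁ A₂] + 2 E[A₁ A₃]` of an expansion with terms
`A₁`, `A₂`, `A₃`. -/
def higherOrderVariance {𝒵 : Type*} [MeasurableSpace 𝒵] (P : ProbabilityMeasure 𝒵)
    (A₁ A₂ A₃ : (n : ℕ) → (Fin n → 𝒵) → ℝ) (n : ℕ) : ℝ :=
  variance (A₂ n) (iid P n) + 2 * √(n : ℝ) * ∫ z, A₁ n z * A₂ n z ∂(iid P n)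
    + 2 * ∫ z, A₁ n z * A₃ n z ∂(iid P n)

/-- The bias-corrected estimator `θ̃ = θ̂ - b̂ / n`. -/
def biasCorrected {𝒵 : Type*} (θhat bhat : (n : ℕ) → (Fin n → 𝒵) → ℝ) (n : ℕ)
    (z : Fin n → 𝒵) : ℝ :=
  θhat n z - bhat n z / (n : ℝ)

/-- The second-order term `Ã₂ = A₂ - b₀` of the bias-corrected estimator. -/
def correctedA₂ {𝒵 : Type*} (A₂ : (n : ℕ) → (Fin n → 𝒵) → ℝ) (b₀ : ℝ) (n : ℕ)
    (z : Fin n → 𝒵) : ℝ :=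
  A₂ n z - b₀

/-- The third-order term `Ã₃ = A₃ - n^{-1/2} ∑ᵢ d(Zᵢ)` of the bias-corrected estimator, where `d`
is the influence function of the bias estimator. -/
def correctedA₃ {𝒵 : Type*} (A₃ : (n : ℕ) → (Fin n → 𝒵) → ℝ) (d : 𝒵 → ℝ) (n : ℕ)
    (z : Fin n → 𝒵) : ℝ :=
  A₃ n z - normalizedSum d n z

/-- `bhat` is an asymptotically linear estimator of the parameter `b` whose influence function is
`d`, where `d` represents the derivative of `b`. -/
structure IsAdmissibleBiasEstimator {𝒵 : Type*} [MeasurableSpace 𝒵]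
    (𝓜 : Set (ProbabilityMeasure 𝒵)) (P₀ : ProbabilityMeasure 𝒵)
    (b : ProbabilityMeasure 𝒵 → ℝ) (bhat : (n : ℕ) → (Fin n → 𝒵) → ℝ) (d : 𝒵 → ℝ) : Prop where
  measurable : ∀ n, Measurable (bhat n)
  linear : IsAsymptoticallyLinear P₀ bhat (b P₀) d
  gradient : IsGradient 𝓜 P₀ b d

end

end SemiparametricBias

/-!
Everything follows from one fact: the influence function `ψ` of the efficient estimator lies in
the tangent space `𝒯`. Two gradients of `b` differ by an element orthogonal to all scores, hence to
`𝒯`, so `E[ψ d]` is the same for every gradient `d` of `b`; in particular it equals `E[ψ δ]` for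
the projection `δ` of a gradient on `𝒯`, which is the unique efficient influence function. Passing
from `A₂`, `A₃` to the corrected terms changes the higher-order variance only through
`-2 E[A₁ n^{-1/2} ∑ᵢ d(Zᵢ)] = -2 E[ψ d]`.

That `ψ ∈ 𝒯` is `toLp_mem_tangentSet_of_isSemiparametricallyEfficient`. First, `ψ` is a gradient of
`θ` with `E[ψ²] = V`. Along a local alternative in the direction `v`, regularity gives the limiting
characteristic function of `√n (θ̂ - θ₀)` at `1`, namely `exp(i E[d_θ S_v] - V/2)` with `d_θ` a
gradient of `θ` and `S_v` the score in the direction `v`, while differentiability in quadratic mean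
gives `exp(i E[ψ S_v] - E[ψ²]/2)` for the normalized sum of `ψ`
(`RegularSubmodel.tendsto_integral_exp_normalizedSum`). Their difference is the limit of the mean of
a bounded statistic that vanishes in `P₀`-probability. Expanding the product density around
that of `P₀` on the level of square roots shows that this limit is `O(‖v‖²)`
(`norm_integral_pi_ofRoot_sub_le`, `RegularSubmodel.norm_exp_sub_exp_le`), which already forces
`E[ψ²] = V` and `E[ψ S_v] = E[d_θ S_v]`; neither contiguity nor an expansion of the likelihood
ratio is needed. Second, the projection of `ψ` on `𝒯` also represents the derivative of `θ`, so by
the Cauchy–Schwarz inequality its squared norm is at least every Cramér–Rao bound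
(`RegularSubmodel.cramerRaoBound_le_norm_sq`), hence at least `V = E[ψ²]`. So `ψ` equals its
projection.
-/

namespace SemiparametricBias

/-! ### Root densities of product measures -/

lemma integral_mul_le_sqrt_mul_sqrt {Ω : Type*} [MeasurableSpace Ω] {ν : Measure Ω} {f g : Ω → ℝ}
    (hf : MemLp f 2 ν) (hg : MemLp g 2 ν) :
    |∫ z, f z * g z ∂ν| ≤ √(∫ z, f z ^ 2 ∂ν) * √(∫ z, g z ^ 2 ∂ν) := by
  have key : ∀ {u v : Ω → ℝ} (hu : MemLp u 2 ν) (hv : MemLp v 2 ν),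
      inner ℝ (hu.toLp u) (hv.toLp v) = ∫ z, u z * v z ∂ν := by
    intro u v hu hv
    rw [L2.inner_def]
    refine integral_congr_ae ?_
    filter_upwards [hu.coeFn_toLp, hv.coeFn_toLp] with z h1 h2
    rw [h1, h2]
    simp [mul_comm]
  have hn : ∀ {u : Ω → ℝ} (hu : MemLp u 2 ν), ‖hu.toLp u‖ = √(∫ z, u z ^ 2 ∂ν) := by
    intro u hu
    rw [norm_eq_sqrt_real_inner, key hu hu]
    simp_rw [pow_two]
  rw [← key hf hg, ← hn hf, ← hn hg]
  exact abs_real_inner_le_norm _ _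

lemma integral_sq_eq_norm_sq {Ω : Type*} [MeasurableSpace Ω] {ν : Measure Ω} (f : Lp ℝ 2 ν) :
    ∫ z, (f : Ω → ℝ) z ^ 2 ∂ν = ‖f‖ ^ 2 := by
  rw [← real_inner_self_eq_norm_sq, L2.inner_def]
  refine integral_congr_ae (ae_of_all _ fun z => ?_)
  simp [pow_two]

section RootDensity

variable {𝒵 : Type*} [MeasurableSpace 𝒵] {μ : Measure 𝒵}

/-- The measure with square-root density `r` with respect to `μ`. -/
noncomputable abbrev ofRoot (μ : Measure 𝒵) (r : 𝒵 → ℝ) : Measure 𝒵 :=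
  μ.withDensity fun z => ENNReal.ofReal (r z ^ 2)

lemma integral_ofRoot {E : Type*} [NormedAddCommGroup E] [NormedSpace ℝ E] {r : 𝒵 → ℝ}
    (hr : Measurable r) (X : 𝒵 → E) : ∫ z, X z ∂ofRoot μ r = ∫ z, r z ^ 2 • X z ∂μ := by
  rw [ofRoot, integral_withDensity_eq_integral_toReal_smul (by fun_prop) (by simp)]
  simp [ENNReal.toReal_ofReal (sq_nonneg _)]

lemma integrable_ofRoot_iff {E : Type*} [NormedAddCommGroup E] [NormedSpace ℝ E] {r : 𝒵 → ℝ}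
    (hr : Measurable r) {X : 𝒵 → E} :
    Integrable X (ofRoot μ r) ↔ Integrable (fun z => r z ^ 2 • X z) μ := by
  rw [ofRoot, integrable_withDensity_iff_integrable_smul' (by fun_prop) (by simp)]
  simp [ENNReal.toReal_ofReal (sq_nonneg _)]

lemma pi_ofRoot [SigmaFinite μ] {r : 𝒵 → ℝ} (hr2 : MemLp r 2 μ)
    [SigmaFinite (ofRoot μ r)] (n : ℕ) :
    Measure.pi (fun _ : Fin n => ofRoot μ r)
      = ofRoot (Measure.pi fun _ : Fin n => μ) fun z => ∏ i, r (z i) := by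
  refine (Measure.pi_eq fun s hs => ?_)
  have hi : ∀ i, Integrable ((s i).indicator fun z => r z ^ 2) μ := fun i =>
    hr2.integrable_sq.indicator (hs i)
  have hnn : ∀ i z, 0 ≤ (s i).indicator (fun z => r z ^ 2) z := fun i z =>
    Set.indicator_nonneg (fun z _ => sq_nonneg _) z
  rw [ofRoot, withDensity_apply _ (MeasurableSet.univ_pi hs),
    ← lintegral_indicator (MeasurableSet.univ_pi hs)]
  have h1 : ∀ z : Fin n → 𝒵, (Set.univ.pi s).indicator
      (fun z => ENNReal.ofReal ((∏ i, r (z i)) ^ 2)) z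
      = ENNReal.ofReal (∏ i, (s i).indicator (fun z => r z ^ 2) (z i)) := by
    intro z
    by_cases hz : z ∈ Set.univ.pi s
    · rw [Set.indicator_of_mem hz, ← Finset.prod_pow]
      congr 1
      exact Finset.prod_congr rfl fun i _ =>
        (Set.indicator_of_mem (hz i trivial) fun z => r z ^ 2).symm
    · rw [Set.indicator_of_notMem hz]
      simp only [Set.mem_pi, Set.mem_univ, true_imp_iff, not_forall] at hz
      obtain ⟨i, hzi⟩ := hz
      rw [Finset.prod_eq_zero (Finset.mem_univ i) (Set.indicator_of_notMem hzi _)]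
      simp
  simp_rw [h1]
  rw [← ofReal_integral_eq_lintegral_ofReal (Integrable.fintype_prod_dep hi)
      (ae_of_all _ fun z => Finset.prod_nonneg fun i _ => hnn i _),
    integral_fintype_prod_eq_prod, ENNReal.ofReal_prod_of_nonneg
      (fun i _ => integral_nonneg (hnn i))]
  refine Finset.prod_congr rfl fun i _ => ?_
  rw [ofReal_integral_eq_lintegral_ofReal (hi i) (ae_of_all _ (hnn i)), ofRoot,
    withDensity_apply _ (hs i), ← lintegral_indicator (hs i)]
  refine lintegral_congr fun z => ?_
  by_cases hz : z ∈ s i <;> simp [hz]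

lemma memLp_prod_root [SigmaFinite μ] {r : 𝒵 → ℝ} (hr : Measurable r) (hr2 : MemLp r 2 μ)
    (n : ℕ) : MemLp (fun z : Fin n → 𝒵 => ∏ i, r (z i)) 2 (Measure.pi fun _ => μ) := by
  have hm : Measurable fun z : Fin n → 𝒵 => ∏ i, r (z i) := by fun_prop
  rw [memLp_two_iff_integrable_sq hm.aestronglyMeasurable]
  simp_rw [← Finset.prod_pow]
  exact Integrable.fintype_prod_dep fun _ => hr2.integrable_sq

lemma integral_sq_sub_of_integral_sq_eq_one {Ω : Type*} [MeasurableSpace Ω] {ν : Measure Ω}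
    {u v : Ω → ℝ} (hu : MemLp u 2 ν) (hv : MemLp v 2 ν) (hu1 : ∫ z, u z ^ 2 ∂ν = 1)
    (hv1 : ∫ z, v z ^ 2 ∂ν = 1) :
    ∫ z, (v z - u z) ^ 2 ∂ν = 2 - 2 * ∫ z, v z * u z ∂ν := by
  have hi : Integrable (fun z => 2 * (v z * u z)) ν := (hv.integrable_mul hu).const_mul 2
  have hi' : Integrable (fun z => v z ^ 2 + u z ^ 2) ν := hv.integrable_sq.add hu.integrable_sq
  have : ∀ z, (v z - u z) ^ 2 = v z ^ 2 + u z ^ 2 - 2 * (v z * u z) := fun z => by ring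
  simp_rw [this]
  rw [integral_sub hi' hi, integral_add hv.integrable_sq hu.integrable_sq, hu1, hv1,
    integral_const_mul]
  norm_num

/-- Tensorization: the squared Hellinger distance between `n`-fold products is at most `n` times
the squared Hellinger distance between the factors. -/
lemma integral_sq_prod_root_sub_le [SigmaFinite μ] {r s : 𝒵 → ℝ} (hr : Measurable r)
    (hs : Measurable s) (hr2 : MemLp r 2 μ) (hs2 : MemLp s 2 μ) (hr1 : ∫ z, r z ^ 2 ∂μ = 1)
    (hs1 : ∫ z, s z ^ 2 ∂μ = 1) (n : ℕ) :
    ∫ z : Fin n → 𝒵, (∏ i, s (z i) - ∏ i, r (z i)) ^ 2 ∂(Measure.pi fun _ => μ)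
      ≤ n * ∫ z, (s z - r z) ^ 2 ∂μ := by
  have one : ∀ {u : 𝒵 → ℝ}, ∫ z, u z ^ 2 ∂μ = 1 →
      ∫ z : Fin n → 𝒵, (∏ i, u (z i)) ^ 2 ∂(Measure.pi fun _ => μ) = 1 := by
    intro u hu
    simp_rw [← Finset.prod_pow]
    rw [integral_fintype_prod_eq_prod (fun _ z => u z ^ 2)]
    simp [hu]
  rw [integral_sq_sub_of_integral_sq_eq_one (memLp_prod_root hr hr2 n) (memLp_prod_root hs hs2 n)
      (one hr1) (one hs1),
    integral_sq_sub_of_integral_sq_eq_one hr2 hs2 hr1 hs1]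
  simp_rw [← Finset.prod_mul_distrib]
  rw [integral_fintype_prod_eq_prod (fun _ z => s z * r z), Finset.prod_const, Finset.card_univ,
    Fintype.card_fin]
  have hb := integral_mul_le_sqrt_mul_sqrt hs2 hr2
  rw [hr1, hs1] at hb
  -- Bernoulli's inequality `1 + n (ρ - 1) ≤ ρ ^ n` for the affinity `ρ = ∫ s r`
  have := one_add_mul_le_pow (a := ∫ z, s z * r z ∂μ - 1)
    (by have := (abs_le.1 hb).1; simp at this; linarith) n
  rw [add_sub_cancel] at this
  linarith

/-- Change of measure for a bounded statistic `X` of an i.i.d. sample. The part of the bound that is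
of first order in the Hellinger distance carries the mean square of `X` as a factor, so that only
the second-order part remains when `X` tends to `0` in mean square under the first law. -/
lemma norm_integral_pi_ofRoot_sub_le [SigmaFinite μ] {r s : 𝒵 → ℝ} (hr : Measurable r)
    (hs : Measurable s) (hr2 : MemLp r 2 μ) (hs2 : MemLp s 2 μ) (hr1 : ∫ z, r z ^ 2 ∂μ = 1)
    (hs1 : ∫ z, s z ^ 2 ∂μ = 1) [SigmaFinite (ofRoot μ r)] [SigmaFinite (ofRoot μ s)] {n : ℕ}
    {X : (Fin n → 𝒵) → ℂ} (hX : Measurable X) {C : ℝ} (hC : 0 ≤ C) (hXC : ∀ z, ‖X z‖ ≤ C) :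
    ‖∫ z, X z ∂(Measure.pi fun _ : Fin n => ofRoot μ s)
        - ∫ z, X z ∂(Measure.pi fun _ : Fin n => ofRoot μ r)‖
      ≤ 2 * (√(∫ z, ‖X z‖ ^ 2 ∂(Measure.pi fun _ : Fin n => ofRoot μ r))
          * √(n * ∫ z, (s z - r z) ^ 2 ∂μ))
        + C * (n * ∫ z, (s z - r z) ^ 2 ∂μ) := by
  have hR := memLp_prod_root hr hr2 n
  have hS := memLp_prod_root hs hs2 n
  have hRm : Measurable fun z : Fin n → 𝒵 => ∏ i, r (z i) := by fun_prop
  have hSm : Measurable fun z : Fin n → 𝒵 => ∏ i, s (z i) := by fun_prop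
  have hH := integral_sq_prod_root_sub_le hr hs hr2 hs2 hr1 hs1 n
  rw [pi_ofRoot hr2, pi_ofRoot hs2, integral_ofRoot hRm, integral_ofRoot hRm,
    integral_ofRoot hSm]
  generalize (n * ∫ z, (s z - r z) ^ 2 ∂μ) = h at *
  generalize hReq : (fun z : Fin n → 𝒵 => ∏ i, r (z i)) = R at *
  generalize hSeq : (fun z : Fin n → 𝒵 => ∏ i, s (z i)) = S at *
  simp only [funext_iff] at hReq hSeq
  simp_rw [hReq, hSeq] at *
  have hintX : ∀ {U : (Fin n → 𝒵) → ℝ}, MemLp U 2 (Measure.pi fun _ : Fin n => μ) →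
      Integrable (fun z => U z ^ 2 • X z) (Measure.pi fun _ : Fin n => μ) := by
    intro U hU
    refine (hU.integrable_sq.mul_const C).mono'
      ((hU.aestronglyMeasurable.pow 2).smul hX.aestronglyMeasurable) (ae_of_all _ fun z => ?_)
    rw [norm_smul, Real.norm_of_nonneg (sq_nonneg _)]
    exact mul_le_mul_of_nonneg_left (hXC z) (sq_nonneg _)
  have hRX : MemLp (fun z => R z * ‖X z‖) 2 (Measure.pi fun _ : Fin n => μ) := by
    refine MemLp.of_le_mul (c := C) hR (hR.aestronglyMeasurable.mul hX.norm.aestronglyMeasurable)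
      (ae_of_all _ fun z => ?_)
    rw [norm_mul, norm_norm, mul_comm]
    exact mul_le_mul_of_nonneg_right (hXC z) (norm_nonneg _)
  rw [← integral_sub (hintX hS) (hintX hR)]
  have hSR : MemLp (fun z => |S z - R z|) 2 (Measure.pi fun _ : Fin n => μ) := (hS.sub hR).norm
  have hpt : ∀ z, ‖S z ^ 2 • X z - R z ^ 2 • X z‖
      ≤ 2 * (|R z * ‖X z‖| * |S z - R z|) + C * |S z - R z| ^ 2 := by
    intro z
    -- `S² - R² = 2 R (S - R) + (S - R)²`: only the first term is of first order in the Hellinger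
    -- distance, and there `X` is integrated against `R`
    have e : S z ^ 2 • X z - R z ^ 2 • X z
        = (2 * (R z * (S z - R z))) • X z + ((S z - R z) ^ 2) • X z := by
      rw [← sub_smul, ← add_smul]; congr 1; ring
    rw [e]
    refine (norm_add_le _ _).trans (add_le_add ?_ ?_)
    · rw [norm_smul]
      simp only [Real.norm_eq_abs, abs_mul, abs_norm, abs_two]
      apply le_of_eq; ring
    · rw [norm_smul, Real.norm_of_nonneg (sq_nonneg _), sq_abs, mul_comm]
      exact mul_le_mul_of_nonneg_right (hXC z) (sq_nonneg _)
  have hRXa : MemLp (fun z => |R z * ‖X z‖|) 2 (Measure.pi fun _ : Fin n => μ) := hRX.norm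
  refine (norm_integral_le_of_norm_le (((hRXa.integrable_mul hSR).const_mul 2).add
    (hSR.integrable_sq.const_mul C)) (ae_of_all _ hpt)).trans ?_
  simp only [Pi.add_apply, Pi.mul_apply]
  have e2 := integral_add ((hRXa.integrable_mul hSR).const_mul 2) (hSR.integrable_sq.const_mul C)
  simp only [Pi.mul_apply] at e2
  rw [e2, integral_const_mul, integral_const_mul]
  have hcs := (le_abs_self _).trans (integral_mul_le_sqrt_mul_sqrt hRXa hSR)
  simp only [sq_abs, mul_pow] at hcs ⊢
  refine add_le_add (mul_le_mul_of_nonneg_left (hcs.trans ?_) zero_le_two) ?_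
  · simp only [smul_eq_mul]
    gcongr
  · gcongr

end RootDensity

/-! ### Characteristic function of a normalized sum under a local alternative -/

lemma tendsto_inv_sqrt_natCast : Tendsto (fun n : ℕ => (√(n : ℝ))⁻¹) atTop (𝓝 0) :=
  tendsto_inv_atTop_zero.comp (Real.tendsto_sqrt_atTop.comp tendsto_natCast_atTop_atTop)

lemma tendsto_inv_sqrt_natCast_nhdsNE :
    Tendsto (fun n : ℕ => (√(n : ℝ))⁻¹) atTop (𝓝[≠] 0) := by
  refine tendsto_nhdsWithin_iff.2 ⟨tendsto_inv_sqrt_natCast, ?_⟩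
  filter_upwards [eventually_gt_atTop 0] with n hn
  have : (0 : ℝ) < n := by exact_mod_cast hn
  simp [(Real.sqrt_pos.2 this).ne']

lemma hasDerivAt_exp_I_mul (x : ℝ) :
    HasDerivAt (fun t : ℝ => Complex.exp (Complex.I * (t * x : ℝ))) (Complex.I * x) 0 := by
  have h : HasDerivAt (fun t : ℝ => Complex.I * ((t * x : ℝ) : ℂ)) (Complex.I * x) 0 := by
    have := ((hasDerivAt_id (0 : ℝ)).mul_const x).ofReal_comp.const_mul Complex.I
    simpa using this
  simpa using h.cexp

/-- The difference `exp (i x / √n) - 1`, whose integrals are the increments from `1` of the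
characteristic function of a summand of a normalized sum. At `n = 0` it vanishes. -/
noncomputable def phaseShift (n : ℕ) (x : ℝ) : ℂ :=
  Complex.exp (Complex.I * ((√(n : ℝ))⁻¹ * x : ℝ)) - 1

@[fun_prop]
lemma measurable_phaseShift (n : ℕ) : Measurable (phaseShift n) := by
  unfold phaseShift; fun_prop

lemma norm_phaseShift_le_two (n : ℕ) (x : ℝ) : ‖phaseShift n x‖ ≤ 2 := by
  refine (norm_sub_le _ _).trans ?_
  rw [mul_comm, Complex.norm_exp_ofReal_mul_I]
  norm_num

lemma norm_sqrt_mul_phaseShift_le (n : ℕ) (x : ℝ) : ‖(√(n : ℝ) : ℂ) * phaseShift n x‖ ≤ |x| := by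
  rw [norm_mul, Complex.norm_real, Real.norm_of_nonneg (Real.sqrt_nonneg _)]
  refine (mul_le_mul_of_nonneg_left Real.norm_exp_I_mul_ofReal_sub_one_le
    (Real.sqrt_nonneg _)).trans ?_
  rw [norm_mul, norm_inv, Real.norm_of_nonneg (Real.sqrt_nonneg _), Real.norm_eq_abs, ← mul_assoc]
  exact mul_le_of_le_one_left (abs_nonneg _) mul_inv_le_one

lemma tendsto_phaseShift (x : ℝ) : Tendsto (fun n => phaseShift n x) atTop (𝓝 0) := by
  have h : Tendsto (fun t : ℝ => Complex.exp (Complex.I * (t * x : ℝ)) - 1) (𝓝 0) (𝓝 0) := by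
    have : Continuous fun t : ℝ => Complex.exp (Complex.I * (t * x : ℝ)) - 1 := by fun_prop
    simpa using this.tendsto 0
  exact h.comp tendsto_inv_sqrt_natCast

lemma tendsto_sqrt_mul_phaseShift (x : ℝ) :
    Tendsto (fun n : ℕ => (√(n : ℝ) : ℂ) * phaseShift n x) atTop (𝓝 (Complex.I * x)) := by
  refine ((hasDerivAt_exp_I_mul x).tendsto_slope_zero.comp
    tendsto_inv_sqrt_natCast_nhdsNE).congr fun n => ?_
  simp [phaseShift]

section

variable {𝒵 : Type*} [MeasurableSpace 𝒵]

lemma tendsto_natCast_mul_integral_phaseShift {P : Measure 𝒵} [IsProbabilityMeasure P] {ψ : 𝒵 → ℝ}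
    (hψ : MemLp ψ 2 P) (h0 : ∫ z, ψ z ∂P = 0) :
    Tendsto (fun n : ℕ => (n : ℂ) * ∫ z, phaseShift n (ψ z) ∂P) atTop
      (𝓝 (-((∫ z, ψ z ^ 2 ∂P : ℝ) : ℂ) / 2)) := by
  have hm : AEMeasurable ψ P := hψ.aestronglyMeasurable.aemeasurable
  have : IsProbabilityMeasure (P.map ψ) := Measure.isProbabilityMeasure_map hm
  have hid : MemLp id 2 (P.map ψ) := by
    rw [memLp_map_measure_iff (by fun_prop) hm]
    exact hψ
  have hT : (fun t : ℝ => charFun (P.map ψ) t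
      - (1 - ((∫ z, ψ z ^ 2 ∂P : ℝ) : ℂ) * t ^ 2 / 2)) =o[𝓝 0] fun t => t ^ 2 := by
    have h2 : (fun t => taylorWithinEval (charFun (P.map ψ)) 2 Set.univ 0 t)
        = fun t : ℝ => 1 - ((∫ z, ψ z ^ 2 ∂P : ℝ) : ℂ) * t ^ 2 / 2 := by
      funext t
      rw [taylorWithinEval_charFun_two_zero hm hid, h0]
      simp
    have h3 := taylor_isLittleO_univ (n := 2) (x₀ := (0 : ℝ)) (contDiff_charFun (μ := P.map ψ) hid)
    simp only [sub_zero] at h3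
    simpa only [h2, funext_iff.1 h2] using h3
  have h4 := (hT.comp_tendsto tendsto_inv_sqrt_natCast).tendsto_inv_smul_nhds_zero
  have h5 := h4.add_const (-((∫ z, ψ z ^ 2 ∂P : ℝ) : ℂ) / 2)
  rw [zero_add] at h5
  refine h5.congr' ?_
  filter_upwards [eventually_gt_atTop 0] with n hn
  have hn' : (n : ℂ) ≠ 0 := by exact_mod_cast hn.ne'
  have hs : ((√(n : ℝ) : ℝ) : ℂ) ^ 2 = n := by
    rw [← Complex.ofReal_pow, Real.sq_sqrt (Nat.cast_nonneg _)]; simp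
  have hi : Integrable (fun z => Complex.exp (Complex.I * ((√(n : ℝ))⁻¹ * ψ z : ℝ))) P := by
    refine (integrable_const (1 : ℝ)).mono' (by fun_prop) (ae_of_all _ fun z => ?_)
    rw [mul_comm, Complex.norm_exp_ofReal_mul_I]
  have hc : charFun (P.map ψ) (√(n : ℝ))⁻¹ = (∫ z, phaseShift n (ψ z) ∂P) + 1 := by
    simp_rw [phaseShift]
    rw [integral_sub hi (integrable_const _), charFun_apply_real, integral_map hm (by fun_prop)]
    simp [mul_comm]
  simp only [Function.comp, hc]
  rw [Complex.real_smul]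
  push_cast
  simp only [inv_pow, inv_inv, hs]
  field_simp
  ring

variable {μ : Measure 𝒵}

/-- An `L²`-convergent sequence tested against a pointwise convergent one dominated in `L²`. -/
lemma tendsto_integral_smul_of_tendsto_integral_sq {u : ℕ → 𝒵 → ℝ} {D G : 𝒵 → ℝ}
    {g : ℕ → 𝒵 → ℂ} {g' : 𝒵 → ℂ} (hu : ∀ n, MemLp (u n) 2 μ) (hD : MemLp D 2 μ) (hG : MemLp G 2 μ)
    (hg : ∀ n, AEStronglyMeasurable (g n) μ) (hgG : ∀ n z, ‖g n z‖ ≤ |G z|)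
    (hgg' : ∀ z, Tendsto (fun n => g n z) atTop (𝓝 (g' z)))
    (huD : Tendsto (fun n => ∫ z, (u n z - D z) ^ 2 ∂μ) atTop (𝓝 0)) :
    Tendsto (fun n => ∫ z, u n z • g n z ∂μ) atTop (𝓝 (∫ z, D z • g' z ∂μ)) := by
  have hGa : MemLp (fun z => |G z|) 2 μ := hG.norm
  have hint : ∀ {v : 𝒵 → ℝ}, MemLp v 2 μ → ∀ n, Integrable (fun z => v z • g n z) μ := by
    intro v hv n
    have hva : MemLp (fun z => |v z|) 2 μ := hv.norm
    refine (hva.integrable_mul hGa).mono' (hv.aestronglyMeasurable.smul (hg n))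
      (ae_of_all _ fun z => ?_)
    rw [norm_smul]
    exact mul_le_mul_of_nonneg_left (hgG n z) (norm_nonneg _)
  have h1 : Tendsto (fun n => ∫ z, D z • g n z ∂μ) atTop (𝓝 (∫ z, D z • g' z ∂μ)) := by
    have hDa : MemLp (fun z => |D z|) 2 μ := hD.norm
    refine tendsto_integral_of_dominated_convergence _ (fun n => (hint hD n).aestronglyMeasurable)
      (hDa.integrable_mul hGa) (fun n => ae_of_all _ fun z => ?_)
      (ae_of_all _ fun z => (hgg' z).const_smul _)
    rw [norm_smul]
    exact mul_le_mul_of_nonneg_left (hgG n z) (norm_nonneg _)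
  have h2 : Tendsto (fun n => ∫ z, (u n z - D z) • g n z ∂μ) atTop (𝓝 0) := by
    have hb : Tendsto (fun n => √(∫ z, (u n z - D z) ^ 2 ∂μ) * √(∫ z, G z ^ 2 ∂μ)) atTop (𝓝 0) := by
      simpa using ((Real.continuous_sqrt.tendsto 0).comp huD).mul_const (√(∫ z, G z ^ 2 ∂μ))
    refine squeeze_zero_norm (fun n => ?_) hb
    have hua : MemLp (fun z => |u n z - D z|) 2 μ := ((hu n).sub hD).norm
    have hcs := (le_abs_self _).trans (integral_mul_le_sqrt_mul_sqrt hua hGa)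
    simp only [sq_abs] at hcs
    refine (norm_integral_le_of_norm_le (hua.integrable_mul hGa)
      (ae_of_all _ fun z => ?_)).trans hcs
    rw [norm_smul]
    exact mul_le_mul_of_nonneg_left (hgG n z) (norm_nonneg _)
  have h3 := h1.add h2
  rw [add_zero] at h3
  refine h3.congr fun n => ?_
  have h4 : Integrable (fun z => (u n z - D z) • g n z) μ := hint ((hu n).sub hD) n
  rw [← integral_add (hint hD n) h4]
  refine integral_congr_ae (ae_of_all _ fun z => ?_)
  dsimp only
  rw [← add_smul]
  congr 1; ring

/-- Along a sequence of root densities `r n` differentiable at `r₀` in quadratic mean with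
derivative `D`, the normalized sum of a centred `ψ` is asymptotically normal with
mean `2 ∫ ψ r₀ D` and variance `∫ ψ² r₀²`. -/
lemma tendsto_integral_exp_pow {r : ℕ → 𝒵 → ℝ} {r₀ D ψ : 𝒵 → ℝ}
    (hr : ∀ n, Measurable (r n)) (hr₀ : Measurable r₀) (hψ : Measurable ψ)
    (hr2 : ∀ n, MemLp (r n) 2 μ) (hr₀2 : MemLp r₀ 2 μ) (hD : MemLp D 2 μ)
    [∀ n, IsProbabilityMeasure (ofRoot μ (r n))] [IsProbabilityMeasure (ofRoot μ r₀)]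
    (hψ2 : MemLp ψ 2 (ofRoot μ r₀)) (hψ0 : ∫ z, ψ z ∂ofRoot μ r₀ = 0)
    (hlim : Tendsto (fun n : ℕ => ∫ z, (√(n : ℝ) * (r n z - r₀ z) - D z) ^ 2 ∂μ) atTop (𝓝 0)) :
    Tendsto (fun n : ℕ =>
        (∫ z, Complex.exp (Complex.I * ((√(n : ℝ))⁻¹ * ψ z : ℝ)) ∂ofRoot μ (r n)) ^ n) atTop
      (𝓝 (Complex.exp (Complex.I * ((2 * ∫ z, ψ z * r₀ z * D z ∂μ : ℝ) : ℂ)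
        - ((∫ z, ψ z ^ 2 ∂ofRoot μ r₀ : ℝ) : ℂ) / 2))) := by
  set u : ℕ → 𝒵 → ℝ := fun n z => √(n : ℝ) * (r n z - r₀ z) with hu
  have hu2 : ∀ n, MemLp (u n) 2 μ := fun n => ((hr2 n).sub hr₀2).const_mul _
  have hψr : MemLp (fun z => ψ z * r₀ z) 2 μ := by
    rw [memLp_two_iff_integrable_sq (by fun_prop)]
    have := (integrable_ofRoot_iff hr₀).1 hψ2.integrable_sq
    refine this.congr (ae_of_all _ fun z => ?_)
    simp only [smul_eq_mul]; ring
  have hme : ∀ n, Measurable fun z => phaseShift n (ψ z) := fun n => by fun_prop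
  have hbd : ∀ {E : 𝒵 → ℝ} (_ : Integrable E μ) (n : ℕ),
      Integrable (fun z => E z • phaseShift n (ψ z)) μ := by
    intro E hE n
    refine (hE.norm.mul_const 2).mono' (hE.aestronglyMeasurable.smul (hme n).aestronglyMeasurable)
      (ae_of_all _ fun z => ?_)
    rw [norm_smul]
    exact mul_le_mul_of_nonneg_left (norm_phaseShift_le_two _ _) (norm_nonneg _)
  -- the cross term of the expansion of `(r n) ^ 2` around `r₀ ^ 2` produces the shift
  have hcross : Tendsto (fun n : ℕ => ∫ z, u n z • ((r₀ z : ℂ) * ((√(n : ℝ) : ℂ)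
      * phaseShift n (ψ z))) ∂μ) atTop
      (𝓝 (∫ z, D z • ((r₀ z : ℂ) * (Complex.I * ψ z)) ∂μ)) := by
    refine tendsto_integral_smul_of_tendsto_integral_sq hu2 hD hψr (fun n => ?_) (fun n z => ?_)
      (fun z => (tendsto_sqrt_mul_phaseShift (ψ z)).const_mul _) hlim
    · exact (Measurable.mul (by fun_prop) ((hme n).const_mul _)).aestronglyMeasurable
    · rw [norm_mul, Complex.norm_real, abs_mul, mul_comm, Real.norm_eq_abs]
      exact mul_le_mul_of_nonneg_right (norm_sqrt_mul_phaseShift_le _ _) (abs_nonneg _)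
  -- the quadratic remainder is negligible
  have hDe : ∀ {v : ℕ → 𝒵 → ℝ}, (∀ n, MemLp (v n) 2 μ) →
      Tendsto (fun n => ∫ z, (v n z - D z) ^ 2 ∂μ) atTop (𝓝 0) →
      Tendsto (fun n : ℕ => ∫ z, v n z • ((D z : ℂ) * phaseShift n (ψ z)) ∂μ) atTop (𝓝 0) := by
    intro v hv hvD
    have := tendsto_integral_smul_of_tendsto_integral_sq (g' := fun _ => 0)
      (g := fun n z => (D z : ℂ) * phaseShift n (ψ z)) hv hD (hD.const_mul 2)
      (fun n => (Complex.continuous_ofReal.comp_aestronglyMeasurable hD.aestronglyMeasurable).mul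
        (hme n).aestronglyMeasurable) (fun n z => ?_)
      (fun z => by simpa using (tendsto_phaseShift (ψ z)).const_mul (D z : ℂ)) hvD
    · simpa using this
    · rw [norm_mul, Complex.norm_real, abs_mul, abs_two, mul_comm, Real.norm_eq_abs]
      exact mul_le_mul_of_nonneg_right (norm_phaseShift_le_two _ _) (abs_nonneg _)
  have hsq : Tendsto (fun n : ℕ => ∫ z, (u n z - D z) ^ 2 • phaseShift n (ψ z) ∂μ) atTop
      (𝓝 0) := by
    refine squeeze_zero_norm (fun n => ?_) (by simpa using hlim.mul_const 2)
    rw [← integral_mul_const]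
    refine norm_integral_le_of_norm_le (((hu2 n).sub hD).integrable_sq.mul_const 2)
      (ae_of_all _ fun z => ?_)
    rw [norm_smul, Real.norm_of_nonneg (sq_nonneg _)]
    exact mul_le_mul_of_nonneg_left (norm_phaseShift_le_two _ _) (sq_nonneg _)
  have hquad : Tendsto (fun n : ℕ => ∫ z, (u n z) ^ 2 • phaseShift n (ψ z) ∂μ) atTop (𝓝 0) := by
    have h1 := hDe hu2 hlim
    have h2 := hDe (v := fun _ => D) (fun _ => hD) (by simp)
    have h3 := (hsq.add (h1.const_mul 2)).sub h2
    simp only [mul_zero, add_zero, sub_zero] at h3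
    refine h3.congr fun n => ?_
    have i1 := hbd ((hu2 n).sub hD).integrable_sq n
    have i2 : Integrable (fun z => 2 * u n z • ((D z : ℂ) * phaseShift n (ψ z))) μ := by
      refine ((hbd ((hu2 n).integrable_mul hD) n).const_mul 2).congr (ae_of_all _ fun z => ?_)
      simp [mul_assoc]
    have i3 : Integrable (fun z => D z • ((D z : ℂ) * phaseShift n (ψ z))) μ := by
      refine (hbd (hD.integrable_mul hD) n).congr (ae_of_all _ fun z => ?_)
      simp [mul_assoc]
    simp only [Pi.sub_apply] at i1
    have i12 := i1.add i2
    simp only [Pi.add_def] at i12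
    rw [← integral_const_mul, ← integral_add i1 i2, ← integral_sub i12 i3]
    refine integral_congr_ae (ae_of_all _ fun z => ?_)
    simp only [Complex.real_smul]
    push_cast
    ring
  have hmain := tendsto_natCast_mul_integral_phaseShift hψ2 hψ0
  refine (Complex.tendsto_one_add_pow_exp_of_tendsto
    (g := fun n => ∫ z, phaseShift n (ψ z) ∂ofRoot μ (r n)) ?_).congr fun n => ?_
  · have h := (hmain.add (hcross.const_mul 2)).add hquad
    have hlimeq : -((∫ z, ψ z ^ 2 ∂ofRoot μ r₀ : ℝ) : ℂ) / 2
        + 2 * ∫ z, D z • ((r₀ z : ℂ) * (Complex.I * ψ z)) ∂μ + 0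
        = Complex.I * ((2 * ∫ z, ψ z * r₀ z * D z ∂μ : ℝ) : ℂ)
        - ((∫ z, ψ z ^ 2 ∂ofRoot μ r₀ : ℝ) : ℂ) / 2 := by
      have : ∫ z, D z • ((r₀ z : ℂ) * (Complex.I * ψ z)) ∂μ
          = Complex.I * ((∫ z, ψ z * r₀ z * D z ∂μ : ℝ) : ℂ) := by
        rw [← integral_complex_ofReal, ← integral_const_mul]
        refine integral_congr_ae (ae_of_all _ fun z => ?_)
        simp only [Complex.real_smul]
        push_cast; ring
      rw [this]
      push_cast; ring
    rw [hlimeq] at h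
    refine h.congr fun n => ?_
    rw [integral_ofRoot hr₀, integral_ofRoot (hr n)]
    have i1 : Integrable (fun z => (n : ℂ) * r₀ z ^ 2 • phaseShift n (ψ z)) μ :=
      (hbd hr₀2.integrable_sq n).const_mul _
    have i2 : Integrable (fun z => 2 * u n z • ((r₀ z : ℂ) * ((√(n : ℝ) : ℂ)
        * phaseShift n (ψ z)))) μ := by
      refine ((hbd ((hu2 n).integrable_mul hr₀2) n).const_mul (2 * √(n : ℝ) : ℂ)).congr
        (ae_of_all _ fun z => ?_)
      simp only [Pi.mul_apply, Complex.real_smul]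
      push_cast; ring
    have i3 := hbd (hu2 n).integrable_sq n
    have i12 := i1.add i2
    simp only [Pi.add_def] at i12
    rw [← integral_const_mul, ← integral_const_mul, ← integral_const_mul,
      ← integral_add i1 i2, ← integral_add i12 i3]
    refine integral_congr_ae (ae_of_all _ fun z => ?_)
    have hs : (n : ℂ) = (√(n : ℝ) : ℂ) ^ 2 := by
      rw [← Complex.ofReal_pow, Real.sq_sqrt (Nat.cast_nonneg _)]; simp
    simp only [Complex.real_smul, hu]
    rw [hs]
    push_cast
    ring
  · congr 1
    have hi : Integrable (fun z => Complex.exp (Complex.I * ((√(n : ℝ))⁻¹ * ψ z : ℝ)))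
        (ofRoot μ (r n)) := by
      refine (integrable_const (1 : ℝ)).mono' (by fun_prop) (ae_of_all _ fun z => ?_)
      rw [mul_comm, Complex.norm_exp_ofReal_mul_I]
    simp_rw [phaseShift]
    rw [integral_sub hi (integrable_const _)]
    simp

lemma integral_exp_normalizedSum {P : Measure 𝒵} [SigmaFinite P] (ψ : 𝒵 → ℝ) (n : ℕ) :
    ∫ z, Complex.exp (Complex.I * (normalizedSum ψ n z : ℝ)) ∂(Measure.pi fun _ : Fin n => P)
      = (∫ z, Complex.exp (Complex.I * ((√(n : ℝ))⁻¹ * ψ z : ℝ)) ∂P) ^ n := by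
  have := integral_fintype_prod_eq_pow (ι := Fin n) (μ := P)
    (fun z => Complex.exp (Complex.I * ((√(n : ℝ))⁻¹ * ψ z : ℝ)))
  rw [Fintype.card_fin] at this
  rw [← this]
  refine integral_congr_ae (ae_of_all _ fun z => ?_)
  simp only [← Complex.exp_sum, normalizedSum]
  congr 1
  push_cast
  simp only [Finset.mul_sum]

end

/-! ### Regular asymptotically linear estimators have gradients as influence functions -/

variable {𝒵 : Type*} [MeasurableSpace 𝒵]

lemma normalizedSum_ae_eq {P : ProbabilityMeasure 𝒵} {φ φ' : 𝒵 → ℝ}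
    (h : φ =ᵐ[(P : Measure 𝒵)] φ') (n : ℕ) :
    normalizedSum φ n =ᵐ[iid P n] normalizedSum φ' n := by
  have h1 : ∀ i : Fin n, ∀ᵐ z ∂(iid P n), φ (z i) = φ' (z i) := fun i =>
    (measurePreserving_eval (fun _ : Fin n => (P : Measure 𝒵)) i).quasiMeasurePreserving.ae h
  filter_upwards [ae_all_iff.2 h1] with z hz
  simp only [normalizedSum, hz]

lemma IsAsymptoticallyLinear.congr_ae {P : ProbabilityMeasure 𝒵}
    {est : (n : ℕ) → (Fin n → 𝒵) → ℝ} {v : ℝ} {φ φ' : 𝒵 → ℝ}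
    (hlin : IsAsymptoticallyLinear P est v φ) (h : φ =ᵐ[(P : Measure 𝒵)] φ') :
    IsAsymptoticallyLinear P est v φ' where
  memLp := hlin.memLp.ae_eq h
  mean_zero := by rw [← integral_congr_ae h]; exact hlin.mean_zero
  expansion := by
    intro ε hε
    refine (hlin.expansion ε hε).congr fun n => measure_congr ?_
    filter_upwards [normalizedSum_ae_eq h n] with z hz
    apply propext
    change ε ≤ |_ - normalizedSum φ n z| ↔ ε ≤ |_ - normalizedSum φ' n z|
    rw [hz]

/-- A bounded statistic dominated by an `o_p(1)` sequence tends to `0` in mean square. Neither the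
sets in the definition of `o_p(1)` nor `Y` need be measurable. -/
lemma IsLittleOInProb.tendsto_integral_norm_sq {P : ProbabilityMeasure 𝒵}
    {Y : (n : ℕ) → (Fin n → 𝒵) → ℝ} (hY : IsLittleOInProb P Y) {X : (n : ℕ) → (Fin n → 𝒵) → ℂ}
    (hX : ∀ n, Measurable (X n)) (hX2 : ∀ n z, ‖X n z‖ ≤ 2) (hXY : ∀ n z, ‖X n z‖ ≤ |Y n z|) :
    Tendsto (fun n => ∫ z, ‖X n z‖ ^ 2 ∂(iid P n)) atTop (𝓝 0) := by
  rw [Metric.tendsto_atTop]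
  intro ε hε
  have hδ : 0 < √(ε / 2) := Real.sqrt_pos.2 (by positivity)
  have h8 : (0 : ℝ≥0∞) < ENNReal.ofReal (ε / 16) := by simpa using hε
  obtain ⟨N, hN⟩ := eventually_atTop.1 ((hY _ hδ).eventually_lt_const h8)
  refine ⟨N, fun n hn => ?_⟩
  rw [Real.dist_eq, sub_zero, abs_of_nonneg (integral_nonneg fun _ => sq_nonneg _)]
  set S : Set (Fin n → 𝒵) := {z | √(ε / 2) ≤ ‖X n z‖} with hS
  have hSm : MeasurableSet S := measurableSet_le measurable_const (hX n).norm
  have hpt : ∀ z, ‖X n z‖ ^ 2 ≤ ε / 2 + S.indicator (fun _ => (4 : ℝ)) z := by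
    intro z
    by_cases hz : z ∈ S
    · rw [Set.indicator_of_mem hz]
      nlinarith [hX2 n z, norm_nonneg (X n z)]
    · rw [Set.indicator_of_notMem hz, add_zero, ← Real.sq_sqrt (by positivity : 0 ≤ ε / 2)]
      exact pow_le_pow_left₀ (norm_nonneg _) (not_le.1 hz).le 2
  have hint : Integrable (fun z => ε / 2 + S.indicator (fun _ => (4 : ℝ)) z) (iid P n) :=
    (integrable_const _).add ((integrable_const _).indicator hSm)
  have hμS : (iid P n).real S < ε / 16 := by
    refine (ENNReal.toReal_lt_of_lt_ofReal ?_)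
    exact (measure_mono fun z hz => hz.trans (hXY n z)).trans_lt (hN n hn)
  calc ∫ z, ‖X n z‖ ^ 2 ∂(iid P n) ≤ ∫ z, (ε / 2 + S.indicator (fun _ => (4 : ℝ)) z) ∂(iid P n) :=
        integral_mono_of_nonneg (ae_of_all _ fun _ => sq_nonneg _) hint (ae_of_all _ hpt)
    _ = ε / 2 + (iid P n).real S * 4 := by
        rw [integral_add (integrable_const _) ((integrable_const _).indicator hSm),
          integral_indicator_const _ hSm]
        simp
    _ < ε := by linarith

lemma norm_exp_I_mul_sub_le (x y : ℝ) :
    ‖Complex.exp (Complex.I * x) - Complex.exp (Complex.I * y)‖ ≤ |x - y| := by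
  have : Complex.exp (Complex.I * x) - Complex.exp (Complex.I * y)
      = Complex.exp (y * Complex.I) * (Complex.exp (Complex.I * (x - y : ℝ)) - 1) := by
    rw [mul_sub, ← Complex.exp_add, mul_one, mul_comm (y : ℂ)]
    congr 2
    push_cast; ring
  rw [this, norm_mul, Complex.norm_exp_ofReal_mul_I, one_mul]
  exact Real.norm_exp_I_mul_ofReal_sub_one_le

lemma norm_exp_I_mul_sub_le_two (x y : ℝ) :
    ‖Complex.exp (Complex.I * x) - Complex.exp (Complex.I * y)‖ ≤ 2 := by
  refine (norm_sub_le _ _).trans ?_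
  rw [mul_comm, Complex.norm_exp_ofReal_mul_I, mul_comm, Complex.norm_exp_ofReal_mul_I]
  norm_num

lemma tendsto_sqrt_smul_slope {E F : Type*} [NormedAddCommGroup E] [NormedSpace ℝ E]
    [NormedAddCommGroup F] [NormedSpace ℝ F] {f : E → F} {x : E} (hf : DifferentiableAt ℝ f x)
    (v : E) :
    Tendsto (fun n : ℕ => √(n : ℝ) • (f (x + (√(n : ℝ))⁻¹ • v) - f x)) atTop
      (𝓝 (fderiv ℝ f x v)) := by
  have hd : HasDerivAt (fun t : ℝ => f (x + t • v)) (fderiv ℝ f x v) 0 :=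
    hf.hasFDerivAt.hasLineDerivAt v
  refine (hd.tendsto_slope_zero.comp tendsto_inv_sqrt_natCast_nhdsNE).congr fun n => ?_
  simp

namespace RegularSubmodel

variable {𝓜 : Set (ProbabilityMeasure 𝒵)} {P₀ : ProbabilityMeasure 𝒵} (M : RegularSubmodel 𝓜 P₀)

lemma measurable_root (η : EuclideanSpace ℝ (Fin M.dim)) : Measurable (M.root η : 𝒵 → ℝ) :=
  (Lp.stronglyMeasurable _).measurable

lemma law_eq_ofRoot {η : EuclideanSpace ℝ (Fin M.dim)} (hη : η ∈ M.Θ) :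
    (M.law η : Measure 𝒵) = ofRoot M.μ (M.root η) := M.law_eq η hη

lemma base_eq_ofRoot : (P₀ : Measure 𝒵) = ofRoot M.μ (M.root M.η₀) := by
  rw [← M.law_eq_ofRoot M.η₀_mem, M.law_η₀]

lemma integral_root_sq {η : EuclideanSpace ℝ (Fin M.dim)} (hη : η ∈ M.Θ) :
    ∫ z, (M.root η : 𝒵 → ℝ) z ^ 2 ∂M.μ = 1 := by
  have h := integral_ofRoot (μ := M.μ) (M.measurable_root η) (fun _ => (1 : ℝ))
  rw [← M.law_eq_ofRoot hη] at h
  simpa using h.symm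

lemma differentiableAt_root : DifferentiableAt ℝ M.root M.η₀ :=
  (M.contDiffOn.contDiffAt (M.isOpen.mem_nhds M.η₀_mem)).differentiableAt (by simp)

lemma measurable_score (a : EuclideanSpace ℝ (Fin M.dim)) : Measurable (M.score a) := by
  have := M.measurable_root M.η₀
  have h2 : Measurable (fderiv ℝ M.root M.η₀ a : 𝒵 → ℝ) := (Lp.stronglyMeasurable _).measurable
  unfold score
  fun_prop

lemma integral_mul_score (ψ : 𝒵 → ℝ) (a : EuclideanSpace ℝ (Fin M.dim)) :
    ∫ z, ψ z * M.score a z ∂(P₀ : Measure 𝒵)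
      = 2 * ∫ z, ψ z * (M.root M.η₀ : 𝒵 → ℝ) z * (fderiv ℝ M.root M.η₀ a : 𝒵 → ℝ) z ∂M.μ := by
  rw [M.base_eq_ofRoot, integral_ofRoot (M.measurable_root _), ← integral_const_mul]
  refine integral_congr_ae (ae_of_all _ fun z => ?_)
  simp only [score, smul_eq_mul]
  by_cases h : (M.root M.η₀ : 𝒵 → ℝ) z = 0
  · simp [h]
  · field_simp

/-- The local sequence `η₀ + v / √n` in a regular submodel, with the finitely many terms that may
lie outside the parameter space replaced by `η₀`. -/
noncomputable def localSequence (v : EuclideanSpace ℝ (Fin M.dim)) (n : ℕ) :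
    EuclideanSpace ℝ (Fin M.dim) :=
  open Classical in
  if M.η₀ + (√(n : ℝ))⁻¹ • v ∈ M.Θ then M.η₀ + (√(n : ℝ))⁻¹ • v else M.η₀

lemma localSequence_mem (v : EuclideanSpace ℝ (Fin M.dim)) (n : ℕ) :
    M.localSequence v n ∈ M.Θ := by
  unfold localSequence
  split_ifs with h
  · exact h
  · exact M.η₀_mem

lemma eventually_localSequence_eq (v : EuclideanSpace ℝ (Fin M.dim)) :
    ∀ᶠ n : ℕ in atTop, M.localSequence v n = M.η₀ + (√(n : ℝ))⁻¹ • v := by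
  have h : Tendsto (fun n : ℕ => M.η₀ + (√(n : ℝ))⁻¹ • v) atTop (𝓝 M.η₀) := by
    simpa using (tendsto_inv_sqrt_natCast.smul_const v).const_add M.η₀
  filter_upwards [h.eventually (M.isOpen.mem_nhds M.η₀_mem)] with n hn
  exact if_pos hn

lemma isLocalSequence_localSequence (v : EuclideanSpace ℝ (Fin M.dim)) :
    IsLocalSequence M (M.localSequence v) := by
  refine ⟨M.localSequence_mem v, ‖v‖, fun n => ?_⟩
  unfold localSequence
  split_ifs with h
  · rw [add_sub_cancel_left, norm_smul, norm_inv, Real.norm_of_nonneg (Real.sqrt_nonneg _),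
      ← mul_assoc]
    exact mul_le_of_le_one_left (norm_nonneg _) mul_inv_le_one
  · simp

lemma tendsto_sqrt_smul_localSequence {F : Type*} [NormedAddCommGroup F] [NormedSpace ℝ F]
    {f : EuclideanSpace ℝ (Fin M.dim) → F} (hf : DifferentiableAt ℝ f M.η₀)
    (v : EuclideanSpace ℝ (Fin M.dim)) :
    Tendsto (fun n : ℕ => √(n : ℝ) • (f (M.localSequence v n) - f M.η₀)) atTop
      (𝓝 (fderiv ℝ f M.η₀ v)) := by
  refine (tendsto_sqrt_smul_slope hf v).congr' ?_
  filter_upwards [M.eventually_localSequence_eq v] with n hn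
  rw [hn]

lemma integral_root_localSequence_sub (v : EuclideanSpace ℝ (Fin M.dim)) (n : ℕ)
    (D : Lp ℝ 2 M.μ) :
    ∫ z, (√(n : ℝ) * ((M.root (M.localSequence v n) : 𝒵 → ℝ) z - (M.root M.η₀ : 𝒵 → ℝ) z)
        - (D : 𝒵 → ℝ) z) ^ 2 ∂M.μ
      = ‖√(n : ℝ) • (M.root (M.localSequence v n) - M.root M.η₀) - D‖ ^ 2 := by
  rw [← integral_sq_eq_norm_sq]
  refine integral_congr_ae ?_
  filter_upwards [Lp.coeFn_sub (√(n : ℝ) • (M.root (M.localSequence v n) - M.root M.η₀)) D,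
    Lp.coeFn_smul (√(n : ℝ)) (M.root (M.localSequence v n) - M.root M.η₀),
    Lp.coeFn_sub (M.root (M.localSequence v n)) (M.root M.η₀)] with z h1 h2 h3
  rw [h1, Pi.sub_apply, h2, Pi.smul_apply, h3]
  simp

variable {θ : ProbabilityMeasure 𝒵 → ℝ} {est : (n : ℕ) → (Fin n → 𝒵) → ℝ} {ψ : 𝒵 → ℝ}

/-- Limiting characteristic function, at `1`, of a regular estimator centred at the true value
under a local alternative. -/
lemma tendsto_integral_exp_of_isRegularWithLimit
    (hdiff : DifferentiableAt ℝ (fun η => θ (M.law η)) M.η₀)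
    {V : ℝ≥0} (hreg : IsRegularWithLimit 𝓜 P₀ θ est (gaussianReal 0 V))
    (v : EuclideanSpace ℝ (Fin M.dim)) :
    Tendsto (fun n : ℕ => ∫ z, Complex.exp (Complex.I * (√(n : ℝ) * (est n z - θ P₀) : ℝ))
        ∂(iid (M.law (M.localSequence v n)) n)) atTop
      (𝓝 (Complex.exp (Complex.I * (fderiv ℝ (fun η => θ (M.law η)) M.η₀ v : ℝ)
        - (V : ℂ) / 2))) := by
  have h1 := hreg M _ (M.isLocalSequence_localSequence v)
  have h2 := ProbabilityMeasure.tendsto_iff_tendsto_charFun.1 h1.tendsto 1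
  simp only [ProbabilityMeasure.coe_mk, Measure.map_id, charFun_gaussianReal] at h2
  have h3 : Tendsto (fun n : ℕ => Complex.exp (Complex.I *
      (√(n : ℝ) * (θ (M.law (M.localSequence v n)) - θ P₀) : ℝ))) atTop
      (𝓝 (Complex.exp (Complex.I * (fderiv ℝ (fun η => θ (M.law η)) M.η₀ v : ℝ)))) := by
    have h4 := M.tendsto_sqrt_smul_localSequence hdiff v
    simp only [M.law_η₀, smul_eq_mul] at h4
    have hc : Continuous fun x : ℝ => Complex.exp (Complex.I * x) := by fun_prop
    exact (hc.tendsto _).comp h4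
  have h5 := h3.mul h2
  rw [← Complex.exp_add] at h5
  convert h5 using 2 with n
  · rw [charFun_apply_real, integral_map (h1.forall_aemeasurable n) (by fun_prop),
      ← integral_const_mul]
    refine integral_congr_ae (ae_of_all _ fun z => ?_)
    simp only [← Complex.exp_add]
    congr 1
    push_cast; ring
  · congr 1
    push_cast; ring

/-- Limiting characteristic function, at `1`, of a normalized sum under a local alternative. -/
lemma tendsto_integral_exp_normalizedSum (hψm : Measurable ψ)
    (hψ2 : MemLp ψ 2 (P₀ : Measure 𝒵)) (hψ0 : ∫ z, ψ z ∂(P₀ : Measure 𝒵) = 0)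
    (v : EuclideanSpace ℝ (Fin M.dim)) :
    Tendsto (fun n : ℕ => ∫ z, Complex.exp (Complex.I * (normalizedSum ψ n z : ℝ))
        ∂(iid (M.law (M.localSequence v n)) n)) atTop
      (𝓝 (Complex.exp (Complex.I * ((∫ z, ψ z * M.score v z ∂(P₀ : Measure 𝒵) : ℝ) : ℂ)
        - ((∫ z, ψ z ^ 2 ∂(P₀ : Measure 𝒵) : ℝ) : ℂ) / 2))) := by
  have hlaw := fun n => M.law_eq_ofRoot (M.localSequence_mem v n)
  have : ∀ n, IsProbabilityMeasure (ofRoot M.μ (M.root (M.localSequence v n))) := fun n => by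
    rw [← hlaw n]; infer_instance
  have : IsProbabilityMeasure (ofRoot M.μ (M.root M.η₀)) := by
    rw [← M.base_eq_ofRoot]; infer_instance
  rw [M.integral_mul_score]
  simp_rw [iid, integral_exp_normalizedSum]
  rw [M.base_eq_ofRoot] at hψ2 hψ0 ⊢
  simp_rw [hlaw]
  rw [← integral_const_mul]
  have h := tendsto_integral_exp_pow (μ := M.μ) (fun n => M.measurable_root _)
    (M.measurable_root M.η₀)
    hψm (fun n => Lp.memLp (M.root (M.localSequence v n))) (Lp.memLp _)
    (Lp.memLp (fderiv ℝ M.root M.η₀ v)) hψ2 hψ0 ?_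
  · rw [← integral_const_mul] at h
    exact h
  · simp_rw [M.integral_root_localSequence_sub]
    have := ((M.tendsto_sqrt_smul_localSequence M.differentiableAt_root v).sub_const
      (fderiv ℝ M.root M.η₀ v)).norm.pow 2
    simpa using this

/-- For a regular asymptotically linear estimator, the limits of the characteristic functions of
`√n (est - θ P₀)` (given by regularity) and of the normalized sum of its influence function differ,
under the local alternative in the direction `v`, by a term of second order in `v`. The two
sequences are close in probability under `P₀`; the bound on the change of measure
to the local alternative takes the place of contiguity. -/
lemma norm_exp_sub_exp_le
    (hdiff : DifferentiableAt ℝ (fun η => θ (M.law η)) M.η₀) (hest : ∀ n, Measurable (est n))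
    {V : ℝ≥0} (hreg : IsRegularWithLimit 𝓜 P₀ θ est (gaussianReal 0 V)) (hψm : Measurable ψ)
    (hlin : IsAsymptoticallyLinear P₀ est (θ P₀) ψ)
    (v : EuclideanSpace ℝ (Fin M.dim)) :
    ‖Complex.exp (Complex.I * (fderiv ℝ (fun η => θ (M.law η)) M.η₀ v : ℝ) - (V : ℂ) / 2)
      - Complex.exp (Complex.I * ((∫ z, ψ z * M.score v z ∂(P₀ : Measure 𝒵) : ℝ) : ℂ)
        - ((∫ z, ψ z ^ 2 ∂(P₀ : Measure 𝒵) : ℝ) : ℂ) / 2)‖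
      ≤ 2 * ‖fderiv ℝ M.root M.η₀ v‖ ^ 2 := by
  have hsf := M.sigmaFinite
  set X : (n : ℕ) → (Fin n → 𝒵) → ℂ := fun n z =>
    Complex.exp (Complex.I * (√(n : ℝ) * (est n z - θ P₀) : ℝ))
      - Complex.exp (Complex.I * (normalizedSum ψ n z : ℝ)) with hX
  have hns : ∀ n, Measurable (normalizedSum ψ n) := fun n => by unfold normalizedSum; fun_prop
  have hXm : ∀ n, Measurable (X n) := fun n => by
    have := hest n
    have := hns n
    fun_prop
  have hX2 : ∀ n z, ‖X n z‖ ≤ 2 := fun n z => norm_exp_I_mul_sub_le_two _ _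
  have hP := hlin.expansion.tendsto_integral_norm_sq hXm hX2 fun n z => norm_exp_I_mul_sub_le _ _
  have hP1 : Tendsto (fun n => ‖∫ z, X n z ∂(iid P₀ n)‖) atTop (𝓝 0) := by
    refine squeeze_zero (fun _ => norm_nonneg _) (fun n => ?_)
      (by simpa using (Real.continuous_sqrt.tendsto 0).comp hP)
    have hm : MemLp (fun z => ‖X n z‖) 2 (iid P₀ n) :=
      MemLp.of_bound (hXm n).norm.aestronglyMeasurable 2
        (ae_of_all _ fun z => by simpa using hX2 n z)
    have := (le_abs_self _).trans (integral_mul_le_sqrt_mul_sqrt hm (memLp_const (1 : ℝ)))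
    simp only [mul_one, one_pow, integral_const, probReal_univ, smul_eq_mul, Real.sqrt_one] at this
    exact (norm_integral_le_integral_norm _).trans this
  have hQ : Tendsto (fun n => ‖∫ z, X n z ∂(iid (M.law (M.localSequence v n)) n)‖) atTop
      (𝓝 ‖Complex.exp (Complex.I * (fderiv ℝ (fun η => θ (M.law η)) M.η₀ v : ℝ) - (V : ℂ) / 2)
      - Complex.exp (Complex.I * ((∫ z, ψ z * M.score v z ∂(P₀ : Measure 𝒵) : ℝ) : ℂ)
        - ((∫ z, ψ z ^ 2 ∂(P₀ : Measure 𝒵) : ℝ) : ℂ) / 2)‖) := by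
    refine (((M.tendsto_integral_exp_of_isRegularWithLimit hdiff hreg v).sub
      (M.tendsto_integral_exp_normalizedSum hψm hlin.memLp hlin.mean_zero v)).norm).congr
        fun n => ?_
    rw [← integral_sub]
    · refine (integrable_const (1 : ℝ)).mono' ?_ (ae_of_all _ fun z => ?_)
      · have := hest n
        exact Measurable.aestronglyMeasurable (by fun_prop)
      · rw [mul_comm, Complex.norm_exp_ofReal_mul_I]
    · refine (integrable_const (1 : ℝ)).mono' ?_ (ae_of_all _ fun z => ?_)
      · have := hns n
        exact Measurable.aestronglyMeasurable (by fun_prop)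
      · rw [mul_comm, Complex.norm_exp_ofReal_mul_I]
  have hH : Tendsto (fun n : ℕ => (n : ℝ) * ∫ z, ((M.root (M.localSequence v n) : 𝒵 → ℝ) z
      - (M.root M.η₀ : 𝒵 → ℝ) z) ^ 2 ∂M.μ) atTop (𝓝 (‖fderiv ℝ M.root M.η₀ v‖ ^ 2)) := by
    refine ((M.tendsto_sqrt_smul_localSequence M.differentiableAt_root v).norm.pow 2).congr
      fun n => ?_
    have h0 : ∫ z, ((M.root (M.localSequence v n) : 𝒵 → ℝ) z - (M.root M.η₀ : 𝒵 → ℝ) z) ^ 2 ∂M.μ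
        = ‖M.root (M.localSequence v n) - M.root M.η₀‖ ^ 2 := by
      rw [← integral_sq_eq_norm_sq]
      refine integral_congr_ae ?_
      filter_upwards [Lp.coeFn_sub (M.root (M.localSequence v n)) (M.root M.η₀)] with z hz
      rw [hz, Pi.sub_apply]
    rw [h0, norm_smul, mul_pow, Real.norm_of_nonneg (Real.sqrt_nonneg _),
      Real.sq_sqrt (Nat.cast_nonneg _)]
  have hR := (hP1.add ((((Real.continuous_sqrt.tendsto 0).comp hP).mul
    ((Real.continuous_sqrt.tendsto _).comp hH)).const_mul 2)).add (hH.const_mul 2)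
  simp only [Real.sqrt_zero, zero_mul, mul_zero, zero_add] at hR
  refine le_of_tendsto_of_tendsto' hQ hR fun n => ?_
  have hlaw := M.law_eq_ofRoot (M.localSequence_mem v n)
  have hbase := M.base_eq_ofRoot
  have : IsProbabilityMeasure (ofRoot M.μ (M.root (M.localSequence v n))) := by
    rw [← hlaw]; infer_instance
  have : IsProbabilityMeasure (ofRoot M.μ (M.root M.η₀)) := by
    rw [← hbase]; infer_instance
  have hkey := norm_integral_pi_ofRoot_sub_le (μ := M.μ) (M.measurable_root M.η₀)
    (M.measurable_root (M.localSequence v n)) (Lp.memLp _) (Lp.memLp _)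
    (M.integral_root_sq M.η₀_mem) (M.integral_root_sq (M.localSequence_mem v n)) (hXm n)
    zero_le_two (hX2 n)
  rw [← hlaw, ← hbase] at hkey
  simp only [Function.comp]
  have htri := norm_add_le
    (∫ z, X n z ∂(iid (M.law (M.localSequence v n)) n) - ∫ z, X n z ∂(iid P₀ n))
    (∫ z, X n z ∂(iid P₀ n))
  rw [sub_add_cancel] at htri
  linarith

end RegularSubmodel

lemma norm_exp_I_mul_sub_half (c s : ℝ) :
    ‖Complex.exp (Complex.I * (c : ℂ) - (s : ℂ) / 2)‖ = Real.exp (-(s / 2)) := by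
  rw [Complex.norm_exp]
  simp

/-- Two phases that are linear in `t` and agree up to `O(t²)` coincide. -/
lemma eq_of_norm_exp_sub_exp_le_mul_sq {c₁ c₂ C : ℝ}
    (h : ∀ t : ℝ, ‖Complex.exp (Complex.I * (t * c₁ : ℝ)) - Complex.exp (Complex.I * (t * c₂ : ℝ))‖
      ≤ C * t ^ 2) : c₁ = c₂ := by
  have h1 := ((hasDerivAt_exp_I_mul c₁).sub (hasDerivAt_exp_I_mul c₂)).tendsto_slope_zero
  have h2 : Tendsto (fun t : ℝ => C * |t|) (𝓝[≠] 0) (𝓝 0) := by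
    have : Continuous fun t : ℝ => C * |t| := by fun_prop
    simpa using (this.tendsto 0).mono_left nhdsWithin_le_nhds
  have h3 := tendsto_nhds_unique h1 (squeeze_zero_norm' ?_ h2)
  · rw [← mul_sub, mul_eq_zero, or_iff_right Complex.I_ne_zero, sub_eq_zero] at h3
    exact_mod_cast h3
  · filter_upwards [self_mem_nhdsWithin] with t ht
    have ht' : 0 < |t| := abs_pos.2 ht
    have := h t
    simp only [Pi.sub_apply, zero_add, zero_mul, Complex.ofReal_zero, mul_zero, sub_self, sub_zero]
    rw [norm_smul, norm_inv, Real.norm_eq_abs, inv_mul_le_iff₀ ht']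
    refine this.trans (le_of_eq ?_)
    rw [← sq_abs]; ring

namespace RegularSubmodel

variable {𝓜 : Set (ProbabilityMeasure 𝒵)} {P₀ : ProbabilityMeasure 𝒵} (M : RegularSubmodel 𝓜 P₀)
  {θ : ProbabilityMeasure 𝒵 → ℝ} {est : (n : ℕ) → (Fin n → 𝒵) → ℝ} {ψ : 𝒵 → ℝ}

lemma integral_mul_score_smul (ψ : 𝒵 → ℝ) (t : ℝ) (a : EuclideanSpace ℝ (Fin M.dim)) :
    ∫ z, ψ z * M.score (t • a) z ∂(P₀ : Measure 𝒵)
      = t * ∫ z, ψ z * M.score a z ∂(P₀ : Measure 𝒵) := by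
  rw [integral_mul_score, integral_mul_score, (fderiv ℝ M.root M.η₀).map_smul,
    mul_left_comm, ← integral_const_mul t]
  congr 1
  refine integral_congr_ae ?_
  have hsm := Lp.coeFn_smul t (fderiv ℝ M.root M.η₀ a)
  filter_upwards [hsm] with z hz
  rw [hz, Pi.smul_apply, smul_eq_mul]
  ring

/-- The limiting variance of a regular asymptotically linear estimator is that of its influence
function. -/
lemma integral_sq_eq_of_isRegularWithLimit
    (hdiff : DifferentiableAt ℝ (fun η => θ (M.law η)) M.η₀) (hest : ∀ n, Measurable (est n))
    {V : ℝ≥0} (hreg : IsRegularWithLimit 𝓜 P₀ θ est (gaussianReal 0 V)) (hψm : Measurable ψ)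
    (hlin : IsAsymptoticallyLinear P₀ est (θ P₀) ψ) :
    ∫ z, ψ z ^ 2 ∂(P₀ : Measure 𝒵) = V := by
  -- in the direction `0` the two limits coincide, and so do their moduli
  have h := M.norm_exp_sub_exp_le hdiff hest hreg hψm hlin 0
  rw [(fderiv ℝ M.root M.η₀).map_zero, norm_zero] at h
  have h' := sub_eq_zero.1 (norm_le_zero_iff.1 (h.trans (by simp)))
  have h'' := congrArg norm h'
  rw [norm_exp_I_mul_sub_half] at h''
  rw [norm_exp_I_mul_sub_half, Real.exp_eq_exp] at h''
  linarith

/-- Regularity forces the influence function of an asymptotically linear estimator to represent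
the derivative of the parameter: along `t • a` the two phases are linear in `t` and agree up to
`O(t²)`. -/
lemma fderiv_eq_integral_of_isRegularWithLimit
    (hdiff : DifferentiableAt ℝ (fun η => θ (M.law η)) M.η₀) (hest : ∀ n, Measurable (est n))
    {V : ℝ≥0} (hreg : IsRegularWithLimit 𝓜 P₀ θ est (gaussianReal 0 V)) (hψm : Measurable ψ)
    (hlin : IsAsymptoticallyLinear P₀ est (θ P₀) ψ) (a : EuclideanSpace ℝ (Fin M.dim)) :
    fderiv ℝ (fun η => θ (M.law η)) M.η₀ a = ∫ z, ψ z * M.score a z ∂(P₀ : Measure 𝒵) := by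
  refine eq_of_norm_exp_sub_exp_le_mul_sq
    (C := 2 * ‖fderiv ℝ M.root M.η₀ a‖ ^ 2 / Real.exp (-((V : ℝ) / 2))) fun t => ?_
  have h := M.norm_exp_sub_exp_le hdiff hest hreg hψm hlin (t • a)
  rw [M.integral_sq_eq_of_isRegularWithLimit hdiff hest hreg hψm hlin,
    M.integral_mul_score_smul, map_smul, map_smul, norm_smul, mul_pow, Real.norm_eq_abs, sq_abs,
    smul_eq_mul] at h
  have hE : ‖Complex.exp (-(((V : ℝ) : ℂ) / 2))‖ = Real.exp (-((V : ℝ) / 2)) := by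
    have := norm_exp_I_mul_sub_half 0 (V : ℝ)
    simpa using this
  simp only [sub_eq_add_neg _ (((V : ℝ) : ℂ) / 2), Complex.exp_add] at h
  rw [← sub_mul, norm_mul, hE] at h
  rw [div_mul_eq_mul_div, le_div_iff₀ (Real.exp_pos _)]
  linarith

/-! ### The tangent space and the efficiency bound -/

/-- The second moment of the score is at most the Fisher information. The points where the root
density vanishes, at which the score is `0` by the convention for division, are the reason for
proving no more than an inequality. -/
lemma integrable_score_sq_and_integral_le (a : EuclideanSpace ℝ (Fin M.dim)) :
    Integrable (fun z => M.score a z ^ 2) (P₀ : Measure 𝒵) ∧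
      ∫ z, M.score a z ^ 2 ∂(P₀ : Measure 𝒵) ≤ 4 * ‖fderiv ℝ M.root M.η₀ a‖ ^ 2 := by
  have hD : Integrable (fun z => 4 * (fderiv ℝ M.root M.η₀ a : 𝒵 → ℝ) z ^ 2) M.μ :=
    (Lp.memLp (fderiv ℝ M.root M.η₀ a)).integrable_sq.const_mul 4
  have hm : Measurable fun z => (M.root M.η₀ : 𝒵 → ℝ) z ^ 2 • M.score a z ^ 2 :=
    ((M.measurable_root M.η₀).pow_const 2).smul ((M.measurable_score a).pow_const 2)
  have hle : ∀ z, (M.root M.η₀ : 𝒵 → ℝ) z ^ 2 • M.score a z ^ 2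
      ≤ 4 * (fderiv ℝ M.root M.η₀ a : 𝒵 → ℝ) z ^ 2 := by
    intro z
    simp only [score, smul_eq_mul]
    by_cases h : (M.root M.η₀ : 𝒵 → ℝ) z = 0
    · simp [h, sq_nonneg]
    · apply le_of_eq; field_simp; ring
  have hnn : ∀ z, 0 ≤ (M.root M.η₀ : 𝒵 → ℝ) z ^ 2 • M.score a z ^ 2 := fun z => by
    simp only [smul_eq_mul]; positivity
  have hi : Integrable (fun z => (M.root M.η₀ : 𝒵 → ℝ) z ^ 2 • M.score a z ^ 2) M.μ :=
    hD.mono' hm.aestronglyMeasurable (ae_of_all _ fun z => by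
      rw [Real.norm_of_nonneg (hnn z)]; exact hle z)
  rw [M.base_eq_ofRoot, integrable_ofRoot_iff (M.measurable_root _),
    integral_ofRoot (M.measurable_root _), ← integral_sq_eq_norm_sq, ← integral_const_mul]
  exact ⟨hi, integral_mono hi hD hle⟩

lemma memLp_score (a : EuclideanSpace ℝ (Fin M.dim)) :
    MemLp (M.score a) 2 (P₀ : Measure 𝒵) :=
  (memLp_two_iff_integrable_sq (M.measurable_score a).aestronglyMeasurable).2
    (M.integrable_score_sq_and_integral_le a).1

/-- The score in the direction `a` as an element of `L²(P₀)`. -/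
noncomputable def scoreLp (a : EuclideanSpace ℝ (Fin M.dim)) : Lp ℝ 2 (P₀ : Measure 𝒵) :=
  (M.memLp_score a).toLp

lemma scoreLp_mem_tangentSet (a : EuclideanSpace ℝ (Fin M.dim)) :
    M.scoreLp a ∈ tangentSet 𝓜 P₀ :=
  subset_closure ⟨M, a, (M.memLp_score a).coeFn_toLp⟩

lemma inner_scoreLp {u : 𝒵 → ℝ} {f : Lp ℝ 2 (P₀ : Measure 𝒵)}
    (h : (f : 𝒵 → ℝ) =ᵐ[(P₀ : Measure 𝒵)] u) (a : EuclideanSpace ℝ (Fin M.dim)) :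
    inner ℝ f (M.scoreLp a) = ∫ z, u z * M.score a z ∂(P₀ : Measure 𝒵) := by
  rw [L2.inner_def]
  refine integral_congr_ae ?_
  filter_upwards [h, (M.memLp_score a).coeFn_toLp] with z h1 h2
  rw [h1, scoreLp, h2]
  simp [mul_comm]

lemma norm_scoreLp_sq_le (a : EuclideanSpace ℝ (Fin M.dim)) :
    ‖M.scoreLp a‖ ^ 2 ≤ 4 * ‖fderiv ℝ M.root M.η₀ a‖ ^ 2 := by
  refine le_trans (le_of_eq ?_) (M.integrable_score_sq_and_integral_le a).2
  rw [← real_inner_self_eq_norm_sq, M.inner_scoreLp (f := M.scoreLp a)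
    (M.memLp_score a).coeFn_toLp]
  simp_rw [pow_two]

lemma map_toLp_eq_sum {k : ℕ} {F : Type*} [NormedAddCommGroup F] [NormedSpace ℝ F]
    (L : EuclideanSpace ℝ (Fin k) →L[ℝ] F) (a : Fin k → ℝ) :
    L (WithLp.toLp 2 a) = ∑ i, a i • L (EuclideanSpace.single i 1) := by
  have h := (EuclideanSpace.basisFun (Fin k) ℝ).sum_repr (WithLp.toLp 2 a)
  conv_lhs => rw [← h, map_sum]
  simp

lemma four_mul_norm_fderiv_root_sq (a : Fin M.dim → ℝ) :
    4 * ‖fderiv ℝ M.root M.η₀ (WithLp.toLp 2 a)‖ ^ 2 = a ⬝ᵥ M.information.mulVec a := by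
  rw [map_toLp_eq_sum, ← real_inner_self_eq_norm_sq, sum_inner]
  simp_rw [inner_sum, dotProduct, Matrix.mulVec, dotProduct, Finset.mul_sum, information,
    Matrix.of_apply, real_inner_smul_left, real_inner_smul_right]
  refine Finset.sum_congr rfl fun i _ => Finset.sum_congr rfl fun j _ => ?_
  ring

lemma fderiv_toLp_eq_dotProduct (θ : ProbabilityMeasure 𝒵 → ℝ) (a : Fin M.dim → ℝ) :
    fderiv ℝ (fun η => θ (M.law η)) M.η₀ (WithLp.toLp 2 a) = a ⬝ᵥ M.paramGradient θ := by
  rw [map_toLp_eq_sum]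
  rfl

/-- The Cramér–Rao bound of a submodel is at most the squared norm of any square integrable `f`
that represents the derivative of the parameter along the submodel. -/
lemma cramerRaoBound_le_norm_sq {θ : ProbabilityMeasure 𝒵 → ℝ} {f : Lp ℝ 2 (P₀ : Measure 𝒵)}
    (hf : ∀ a, fderiv ℝ (fun η => θ (M.law η)) M.η₀ a = inner ℝ f (M.scoreLp a)) :
    M.cramerRaoBound θ ≤ ‖f‖ ^ 2 := by
  set g := M.paramGradient θ with hg
  -- the least favourable direction
  set a : Fin M.dim → ℝ := (M.information⁻¹).mulVec g with ha
  have hB : M.cramerRaoBound θ = a ⬝ᵥ g := by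
    rw [cramerRaoBound, dotProduct_comm]
  have hdet : IsUnit M.information.det :=
    isUnit_iff_ne_zero.2 (M.information_nonsingular M.η₀ M.η₀_mem)
  have hI : M.information.mulVec a = g := by
    rw [ha, Matrix.mulVec_mulVec, Matrix.mul_nonsing_inv _ hdet, Matrix.one_mulVec]
  have h1 : ‖M.scoreLp (WithLp.toLp 2 a)‖ ^ 2 ≤ a ⬝ᵥ g := by
    refine (M.norm_scoreLp_sq_le _).trans (le_of_eq ?_)
    rw [M.four_mul_norm_fderiv_root_sq, hI]
  have h2 : a ⬝ᵥ g ≤ ‖f‖ * ‖M.scoreLp (WithLp.toLp 2 a)‖ := by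
    rw [← M.fderiv_toLp_eq_dotProduct, hf]
    exact real_inner_le_norm _ _
  rw [hB]
  set s := ‖M.scoreLp (WithLp.toLp 2 a)‖
  nlinarith [sq_nonneg (‖f‖ - s), norm_nonneg f]

end RegularSubmodel

section Gradient

variable {𝓜 : Set (ProbabilityMeasure 𝒵)} {P₀ : ProbabilityMeasure 𝒵}
  {β : ProbabilityMeasure 𝒵 → ℝ}

lemma IsGradient.inner_toLp_scoreLp {d : 𝒵 → ℝ} (hd : IsGradient 𝓜 P₀ β d)
    (M : RegularSubmodel 𝓜 P₀) (a : EuclideanSpace ℝ (Fin M.dim)) :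
    fderiv ℝ (fun η => β (M.law η)) M.η₀ a = inner ℝ (hd.1.toLp d) (M.scoreLp a) := by
  rw [(hd.2 M).2 a, M.inner_scoreLp hd.1.coeFn_toLp]

lemma inner_eq_zero_of_mem_tangentSet {f t : Lp ℝ 2 (P₀ : Measure 𝒵)}
    (h : ∀ (M : RegularSubmodel 𝓜 P₀) a, inner ℝ f (M.scoreLp a) = 0)
    (ht : t ∈ tangentSet 𝓜 P₀) : inner ℝ f t = 0 := by
  have hcl : IsClosed {t : Lp ℝ 2 (P₀ : Measure 𝒵) | inner ℝ f t = 0} :=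
    isClosed_eq (by fun_prop) continuous_const
  refine closure_minimal ?_ hcl ht
  rintro t ⟨M, a, hta⟩
  have : t = M.scoreLp a := Lp.ext (hta.trans (M.memLp_score a).coeFn_toLp.symm)
  rw [this]
  exact h M a

/-- Two gradients of a parameter agree on the tangent set. -/
lemma IsGradient.inner_sub_eq_zero {d d' : 𝒵 → ℝ} (hd : IsGradient 𝓜 P₀ β d)
    (hd' : IsGradient 𝓜 P₀ β d') {t : Lp ℝ 2 (P₀ : Measure 𝒵)} (ht : t ∈ tangentSet 𝓜 P₀) :
    inner ℝ (hd.1.toLp d - hd'.1.toLp d') t = 0 :=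
  inner_eq_zero_of_mem_tangentSet (fun M a => by
    rw [inner_sub_left, ← hd.inner_toLp_scoreLp, ← hd'.inner_toLp_scoreLp, sub_self]) ht

lemma IsGradient.of_inner_eq {d : 𝒵 → ℝ} (hd : IsGradient 𝓜 P₀ β d)
    {f : Lp ℝ 2 (P₀ : Measure 𝒵)}
    (h : ∀ t ∈ tangentSet 𝓜 P₀, inner ℝ (hd.1.toLp d) t = inner ℝ f t) :
    IsGradient 𝓜 P₀ β f :=
  ⟨Lp.memLp f, fun M => ⟨(hd.2 M).1, fun a => by
    rw [hd.inner_toLp_scoreLp, h _ (M.scoreLp_mem_tangentSet a),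
      M.inner_scoreLp (EventuallyEq.refl _ _)]⟩⟩

/-- If the tangent set is linear, a differentiable parameter has exactly one efficient influence
function, the projection of any gradient on the tangent set. -/
lemma exists_unique_isEfficientInfluenceFunction (hT : TangentSetIsLinear 𝓜 P₀)
    (hβ : IsDifferentiableParameter 𝓜 P₀ β) :
    ∃ δ : Lp ℝ 2 (P₀ : Measure 𝒵), ∀ δ', IsEfficientInfluenceFunction 𝓜 P₀ β δ' ↔ δ' = δ := by
  obtain ⟨K, hK⟩ := hT
  obtain ⟨d, hd⟩ := hβ
  have hKc : IsClosed (K : Set (Lp ℝ 2 (P₀ : Measure 𝒵))) := by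
    rw [hK]; exact isClosed_closure
  have : CompleteSpace K := hKc.completeSpace_coe
  have hmem : ∀ t, t ∈ tangentSet 𝓜 P₀ ↔ t ∈ K := fun t => by rw [← hK]; rfl
  have hδ : IsEfficientInfluenceFunction 𝓜 P₀ β (K.starProjection (hd.1.toLp d)) := by
    refine ⟨(hmem _).2 (K.starProjection_apply_mem _), hd.of_inner_eq fun t ht => ?_⟩
    rw [← sub_eq_zero, ← inner_sub_left]
    exact K.starProjection_inner_eq_zero _ _ ((hmem t).1 ht)
  refine ⟨_, fun δ' => ⟨fun hδ' => ?_, fun h => h ▸ hδ⟩⟩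
  have hsub : δ' - K.starProjection (hd.1.toLp d) ∈ tangentSet 𝓜 P₀ :=
    (hmem _).2 (K.sub_mem ((hmem _).1 hδ'.1) ((hmem _).1 hδ.1))
  have h0 := hδ'.2.inner_sub_eq_zero hδ.2 hsub
  rw [Lp.toLp_coeFn, Lp.toLp_coeFn, inner_self_eq_zero] at h0
  exact sub_eq_zero.1 h0

/-- The influence function of an asymptotically linear, semiparametrically efficient estimator lies
in the tangent space: regularity makes it a gradient, and its projection on the tangent space,
which is a gradient too, has at least the norm allowed by the efficiency bound. -/
lemma toLp_mem_tangentSet_of_isSemiparametricallyEfficient (hT : TangentSetIsLinear 𝓜 P₀)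
    (hβ : IsDifferentiableParameter 𝓜 P₀ β) {est : (n : ℕ) → (Fin n → 𝒵) → ℝ}
    (hest : ∀ n, Measurable (est n)) {ψ : 𝒵 → ℝ} (hlin : IsAsymptoticallyLinear P₀ est (β P₀) ψ)
    (heff : IsSemiparametricallyEfficient 𝓜 P₀ β est) :
    hlin.memLp.toLp ψ ∈ tangentSet 𝓜 P₀ := by
  obtain ⟨K, hK⟩ := hT
  obtain ⟨d, hd⟩ := hβ
  obtain ⟨V, hV, hreg⟩ := heff
  have hKc : IsClosed (K : Set (Lp ℝ 2 (P₀ : Measure 𝒵))) := by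
    rw [hK]; exact isClosed_closure
  have : CompleteSpace K := hKc.completeSpace_coe
  set f := hlin.memLp.toLp ψ with hf
  -- `f` is a measurable version of `ψ`, which may itself fail to be measurable along a submodel
  have hae : ψ =ᵐ[(P₀ : Measure 𝒵)] f := hlin.memLp.coeFn_toLp.symm
  have hlin' := hlin.congr_ae hae
  have hfm : Measurable (f : 𝒵 → ℝ) := (Lp.stronglyMeasurable f).measurable
  -- a least upper bound in `ℝ` forces the set of bounds, hence of submodels, to be nonempty
  obtain ⟨_, M₀, -⟩ := hV.nonempty
  have hnorm : ‖f‖ ^ 2 = V := by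
    rw [← integral_sq_eq_norm_sq]
    exact M₀.integral_sq_eq_of_isRegularWithLimit (hd.2 M₀).1 hest hreg hfm hlin'
  have hle : (V : ℝ) ≤ ‖K.starProjection f‖ ^ 2 := by
    refine hV.2 ?_
    rintro _ ⟨M, rfl⟩
    refine M.cramerRaoBound_le_norm_sq fun a => ?_
    rw [M.fderiv_eq_integral_of_isRegularWithLimit (hd.2 M).1 hest hreg hfm hlin' a,
      ← M.inner_scoreLp (EventuallyEq.refl _ _), ← sub_eq_zero, ← inner_sub_left]
    have hmem : M.scoreLp a ∈ (K : Set (Lp ℝ 2 (P₀ : Measure 𝒵))) := by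
      rw [hK]; exact M.scoreLp_mem_tangentSet a
    exact K.starProjection_inner_eq_zero _ _ hmem
  have hpyth : ‖f‖ ^ 2 = ‖K.starProjection f‖ ^ 2 + ‖f - K.starProjection f‖ ^ 2 := by
    have h0 := K.starProjection_inner_eq_zero f _ (K.starProjection_apply_mem f)
    have := norm_add_sq_real (f - K.starProjection f) (K.starProjection f)
    rw [sub_add_cancel, h0] at this
    linarith
  have hz : f = K.starProjection f := by
    rw [← sub_eq_zero, ← norm_eq_zero]
    nlinarith [norm_nonneg (f - K.starProjection f)]
  rw [hz, ← hK]
  exact K.starProjection_apply_mem f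

end Gradient

/-! ### Moments of normalized sums -/

section Moments

variable {P : ProbabilityMeasure 𝒵} {φ χ : 𝒵 → ℝ}

lemma memLp_eval (hφ : MemLp φ 2 (P : Measure 𝒵)) {n : ℕ} (i : Fin n) :
    MemLp (fun z : Fin n → 𝒵 => φ (z i)) 2 (iid P n) :=
  hφ.comp_measurePreserving (measurePreserving_eval (fun _ : Fin n => (P : Measure 𝒵)) i)

lemma memLp_normalizedSum (hφ : MemLp φ 2 (P : Measure 𝒵)) (n : ℕ) :
    MemLp (normalizedSum φ n) 2 (iid P n) :=
  (memLp_finsetSum _ fun i _ => memLp_eval hφ i).const_mul _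

lemma integral_normalizedSum (hφ : MemLp φ 2 (P : Measure 𝒵))
    (h0 : ∫ z, φ z ∂(P : Measure 𝒵) = 0) (n : ℕ) :
    ∫ z, normalizedSum φ n z ∂(iid P n) = 0 := by
  simp_rw [normalizedSum]
  rw [integral_const_mul, integral_finsetSum _ fun i _ => (memLp_eval hφ i).integrable one_le_two]
  have : ∀ i : Fin n, ∫ z : Fin n → 𝒵, φ (z i) ∂(iid P n) = 0 := fun i => by
    rw [iid, integral_comp_eval (μ := fun _ : Fin n => (P : Measure 𝒵)) hφ.aestronglyMeasurable, h0]
  simp [this]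

lemma integral_normalizedSum_mul (hφ : MemLp φ 2 (P : Measure 𝒵)) (hχ : MemLp χ 2 (P : Measure 𝒵))
    (h0 : ∫ z, φ z ∂(P : Measure 𝒵) = 0) {n : ℕ} (hn : 0 < n) :
    ∫ z, normalizedSum φ n z * normalizedSum χ n z ∂(iid P n)
      = ∫ z, φ z * χ z ∂(P : Measure 𝒵) := by
  have hi : ∀ i j : Fin n, Integrable (fun z : Fin n → 𝒵 => φ (z i) * χ (z j)) (iid P n) :=
    fun i j => (memLp_eval hφ i).integrable_mul (memLp_eval hχ j)
  have hij : ∀ i j : Fin n, ∫ z : Fin n → 𝒵, φ (z i) * χ (z j) ∂(iid P n)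
      = if i = j then ∫ z, φ z * χ z ∂(P : Measure 𝒵) else 0 := by
    intro i j
    split_ifs with h
    · subst h
      exact integral_comp_eval (μ := fun _ : Fin n => (P : Measure 𝒵)) (i := i)
        (f := fun z => φ z * χ z) (hφ.aestronglyMeasurable.mul hχ.aestronglyMeasurable)
    · have hind : IndepFun (fun z : Fin n → 𝒵 => z i) (fun z => z j) (iid P n) :=
        (iIndepFun_pi (μ := fun _ : Fin n => (P : Measure 𝒵)) (X := fun _ => id)
          fun _ => aemeasurable_id).indepFun h
      have hmap : ∀ k : Fin n, (iid P n).map (fun z => z k) = (P : Measure 𝒵) := fun k =>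
        (measurePreserving_eval (fun _ : Fin n => (P : Measure 𝒵)) k).map_eq
      have := hind.integral_comp_mul_comp (f := φ) (g := χ)
        (measurable_pi_apply i).aemeasurable (measurable_pi_apply j).aemeasurable
        (by rw [hmap]; exact hφ.aestronglyMeasurable) (by rw [hmap]; exact hχ.aestronglyMeasurable)
      have h1 : ∫ z : Fin n → 𝒵, φ (z i) ∂(iid P n) = 0 := by
        rw [iid, integral_comp_eval (μ := fun _ : Fin n => (P : Measure 𝒵)) hφ.aestronglyMeasurable,
          h0]
      simp only [Function.comp_def, Pi.mul_def] at this
      rw [this, h1, zero_mul]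
  have he : ∀ z : Fin n → 𝒵, normalizedSum φ n z * normalizedSum χ n z
      = (n : ℝ)⁻¹ * ∑ i, ∑ j, φ (z i) * χ (z j) := by
    intro z
    rw [normalizedSum, normalizedSum, mul_mul_mul_comm, Finset.sum_mul_sum, ← mul_inv,
      Real.mul_self_sqrt (Nat.cast_nonneg _)]
  simp_rw [he]
  rw [integral_const_mul, integral_finsetSum _ fun i _ => integrable_finsetSum _ fun j _ => hi i j]
  simp_rw [integral_finsetSum _ fun j _ => hi _ j, hij]
  have : (n : ℝ) ≠ 0 := by exact_mod_cast hn.ne'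
  simp [this]

end Moments

/-! ### Stochastic orders -/

section Orders

variable {P : ProbabilityMeasure 𝒵}
  {X Y : (n : ℕ) → (Fin n → 𝒵) → ℝ}

lemma IsBoundedInProb.sub (hX : IsBoundedInProb P X) (hY : IsBoundedInProb P Y) :
    IsBoundedInProb P fun n z => X n z - Y n z := by
  intro ε hε
  obtain ⟨C, hC⟩ := hX (ε / 2) (ENNReal.half_pos hε.ne')
  obtain ⟨C', hC'⟩ := hY (ε / 2) (ENNReal.half_pos hε.ne')
  refine ⟨C + C', ?_⟩
  filter_upwards [hC, hC'] with n h1 h2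
  rw [← ENNReal.add_halves ε]
  refine (measure_mono fun z hz => ?_).trans ((measure_union_le _ _).trans (add_le_add h1 h2))
  by_contra hcon
  simp only [Set.mem_union, Set.mem_ofPred_eq, not_or, not_lt] at hcon hz
  linarith [abs_sub (X n z) (Y n z)]

lemma isBoundedInProb_const (c : ℝ) : IsBoundedInProb P fun _ _ => c :=
  fun _ _ => ⟨|c|, by simp⟩

lemma IsLittleOInProb.sub (hX : IsLittleOInProb P X) (hY : IsLittleOInProb P Y) :
    IsLittleOInProb P fun n z => X n z - Y n z := by
  intro ε hε
  have h := (hX (ε / 2) (by positivity)).add (hY (ε / 2) (by positivity))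
  rw [add_zero] at h
  refine tendsto_of_tendsto_of_tendsto_of_le_of_le tendsto_const_nhds h (fun _ => zero_le)
    fun n => (measure_mono fun z hz => ?_).trans (measure_union_le _ _)
  by_contra hcon
  simp only [Set.mem_union, Set.mem_ofPred_eq, not_or, not_le] at hcon hz
  linarith [abs_sub (X n z) (Y n z)]

lemma isBoundedInProb_normalizedSum {φ : 𝒵 → ℝ} (hφ : MemLp φ 2 (P : Measure 𝒵))
    (h0 : ∫ z, φ z ∂(P : Measure 𝒵) = 0) : IsBoundedInProb P (normalizedSum φ) := by
  intro ε hε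
  set v := ∫ z, φ z * φ z ∂(P : Measure 𝒵) with hv
  have hv0 : 0 ≤ v := integral_nonneg fun z => mul_self_nonneg _
  obtain ⟨δ, hδ, hδε⟩ : ∃ δ : ℝ, 0 < δ ∧ ENNReal.ofReal δ ≤ ε := by
    obtain ⟨δ, h1, h2⟩ := ENNReal.lt_iff_exists_nnreal_btwn.1 hε
    exact ⟨δ, by exact_mod_cast h1, by simpa using h2.le⟩
  refine ⟨√((v + 1) / δ), ?_⟩
  have hc : 0 < √((v + 1) / δ) := Real.sqrt_pos.2 (by positivity)
  filter_upwards [eventually_gt_atTop 0] with n hn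
  have h := meas_ge_le_variance_div_sq (memLp_normalizedSum hφ n) hc
  rw [integral_normalizedSum hφ h0] at h
  simp only [sub_zero] at h
  have hsub : {z | √((v + 1) / δ) < |normalizedSum φ n z|}
      ⊆ {z | √((v + 1) / δ) ≤ |normalizedSum φ n z|} := by
    intro z hz
    simp only [Set.mem_ofPred_eq] at hz ⊢
    exact hz.le
  refine (measure_mono hsub).trans (h.trans ?_)
  refine (ENNReal.ofReal_le_ofReal ?_).trans hδε
  rw [variance_of_integral_eq_zero (memLp_normalizedSum hφ n).aemeasurable
    (integral_normalizedSum hφ h0 n)]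
  simp_rw [pow_two (normalizedSum φ n _)]
  rw [integral_normalizedSum_mul hφ hφ h0 hn, Real.sq_sqrt (by positivity), ← hv,
    div_div_eq_mul_div, div_le_iff₀ (by positivity)]
  nlinarith

end Orders

/-! ### Bias correction -/

section Correction

variable {P : ProbabilityMeasure 𝒵}
  {θhat bhat A₂ A₃ : (n : ℕ) → (Fin n → 𝒵) → ℝ} {θ₀ b₀ : ℝ} {ψ d : 𝒵 → ℝ}

/-- Since `n (√n b̂ / n) = √n b̂`, the bias estimator enters the expansion through `√n b₀`, which
corrects `A₂`, and its normalized sum, which corrects `A₃`. -/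
lemma HasThirdOrderExpansion.biasCorrected
    (hexp : HasThirdOrderExpansion P θhat θ₀ (normalizedSum ψ) A₂ A₃)
    (hb : IsAsymptoticallyLinear P bhat b₀ d) :
    HasThirdOrderExpansion P (biasCorrected θhat bhat) θ₀ (normalizedSum ψ)
      (correctedA₂ A₂ b₀) (correctedA₃ A₃ d) where
  bounded₁ := hexp.bounded₁
  bounded₂ := hexp.bounded₂.sub (isBoundedInProb_const b₀)
  bounded₃ := hexp.bounded₃.sub (isBoundedInProb_normalizedSum hb.memLp hb.mean_zero)
  expansion := by
    intro ε hε
    refine ((hexp.expansion.sub hb.expansion) ε hε).congr' ?_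
    filter_upwards [eventually_gt_atTop 0] with n hn
    have hn' : (0 : ℝ) < n := by exact_mod_cast hn
    have hs : √(n : ℝ) ≠ 0 := (Real.sqrt_pos.2 hn').ne'
    have hss : (n : ℝ) = √(n : ℝ) ^ 2 := (Real.sq_sqrt hn'.le).symm
    congr 1
    ext z
    simp only [Set.mem_ofPred_eq, SemiparametricBias.biasCorrected, correctedA₂, correctedA₃]
    generalize normalizedSum d n z = S
    generalize √(n : ℝ) = s at *
    rw [hss]
    have : s ^ 2 * (s * (θhat n z - θ₀) - (normalizedSum ψ n z + A₂ n z / s + A₃ n z / s ^ 2))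
        - (s * (bhat n z - b₀) - S)
        = s ^ 2 * (s * (θhat n z - bhat n z / s ^ 2 - θ₀)
          - (normalizedSum ψ n z + (A₂ n z - b₀) / s + (A₃ n z - S) / s ^ 2)) := by
      field_simp
      ring
    rw [this]

/-- The shift of `A₂` by a constant changes neither its variance nor its covariance with the centred
`A₁`; the correction of `A₃` contributes the covariance of two normalized sums. -/
lemma higherOrderVariance_corrected (hψ : MemLp ψ 2 (P : Measure 𝒵))
    (hψ0 : ∫ z, ψ z ∂(P : Measure 𝒵) = 0) (hd : MemLp d 2 (P : Measure 𝒵)) {n : ℕ} (hn : 0 < n)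
    (hA₂ : MemLp (A₂ n) 2 (iid P n))
    (hA₃ : Integrable (fun z => normalizedSum ψ n z * A₃ n z) (iid P n)) :
    higherOrderVariance P (normalizedSum ψ) (correctedA₂ A₂ b₀) (correctedA₃ A₃ d) n
      = higherOrderVariance P (normalizedSum ψ) A₂ A₃ n - 2 * ∫ z, ψ z * d z ∂(P : Measure 𝒵) := by
  have hS := memLp_normalizedSum hψ n
  have hSA : Integrable (fun z => normalizedSum ψ n z * A₂ n z) (iid P n) := hS.integrable_mul hA₂
  have hSd : Integrable (fun z => normalizedSum ψ n z * normalizedSum d n z) (iid P n) :=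
    hS.integrable_mul (memLp_normalizedSum hd n)
  have h1 : variance (correctedA₂ A₂ b₀ n) (iid P n) = variance (A₂ n) (iid P n) :=
    variance_sub_const hA₂.aestronglyMeasurable b₀
  have h2 : ∫ z, normalizedSum ψ n z * correctedA₂ A₂ b₀ n z ∂(iid P n)
      = ∫ z, normalizedSum ψ n z * A₂ n z ∂(iid P n) := by
    simp_rw [correctedA₂, mul_sub]
    rw [integral_sub hSA ((hS.integrable one_le_two).mul_const _), integral_mul_const,
      integral_normalizedSum hψ hψ0, zero_mul, sub_zero]
  have h3 : ∫ z, normalizedSum ψ n z * correctedA₃ A₃ d n z ∂(iid P n)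
      = ∫ z, normalizedSum ψ n z * A₃ n z ∂(iid P n) - ∫ z, ψ z * d z ∂(P : Measure 𝒵) := by
    simp_rw [correctedA₃, mul_sub]
    rw [integral_sub hA₃ hSd, integral_normalizedSum_mul hψ hd hψ0 hn]
  rw [higherOrderVariance, higherOrderVariance, h1, h2, h3]
  ring

end Correction

end SemiparametricBias

open SemiparametricBias in
theorem theorem1 {𝒵 : Type*} [MeasurableSpace 𝒵]
    (𝓜 : Set (ProbabilityMeasure 𝒵)) (P₀ : ProbabilityMeasure 𝒵) (hP₀ : P₀ ∈ 𝓜)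
    (θ b : ProbabilityMeasure 𝒵 → ℝ)
    (hT : TangentSetIsLinear 𝓜 P₀)
    (hθ : IsDifferentiableParameter 𝓜 P₀ θ)
    (hb : IsDifferentiableParameter 𝓜 P₀ b)
    (θhat : (n : ℕ) → (Fin n → 𝒵) → ℝ) (hθhat : ∀ n, Measurable (θhat n))
    (ψ : 𝒵 → ℝ) (hlin : IsAsymptoticallyLinear P₀ θhat (θ P₀) ψ)
    (heff : IsSemiparametricallyEfficient 𝓜 P₀ θ θhat)
    (A₂ A₃ : (n : ℕ) → (Fin n → 𝒵) → ℝ)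
    (hexp : HasThirdOrderExpansion P₀ θhat (θ P₀) (normalizedSum ψ) A₂ A₃)
    (hA₂ : ∀ n, 0 < n → MemLp (A₂ n) 2 (iid P₀ n))
    (hA₁A₃ : ∀ n, 0 < n → Integrable (fun z => normalizedSum ψ n z * A₃ n z) (iid P₀ n))
    (hb₀ : ∀ n, 0 < n → ∫ z, A₂ n z ∂(iid P₀ n) = b P₀) :
    ∃ δ : Lp ℝ 2 (P₀ : Measure 𝒵),
      (∀ δ' : Lp ℝ 2 (P₀ : Measure 𝒵), IsEfficientInfluenceFunction 𝓜 P₀ b δ' ↔ δ' = δ) ∧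
      (∀ (bhat : (n : ℕ) → (Fin n → 𝒵) → ℝ) (d : 𝒵 → ℝ),
        IsAdmissibleBiasEstimator 𝓜 P₀ b bhat d →
          HasThirdOrderExpansion P₀ (biasCorrected θhat bhat) (θ P₀) (normalizedSum ψ)
            (correctedA₂ A₂ (b P₀)) (correctedA₃ A₃ d) ∧
          ∫ z, ψ z * d z ∂(P₀ : Measure 𝒵) = ∫ z, ψ z * δ z ∂(P₀ : Measure 𝒵) ∧
          ∀ n, 0 < n →
            higherOrderVariance P₀ (normalizedSum ψ)
                (correctedA₂ A₂ (b P₀)) (correctedA₃ A₃ d) n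
              = higherOrderVariance P₀ (normalizedSum ψ) A₂ A₃ n
                - 2 * ∫ z, ψ z * δ z ∂(P₀ : Measure 𝒵)) ∧
      (∀ (bhat bhat' : (n : ℕ) → (Fin n → 𝒵) → ℝ) (d d' : 𝒵 → ℝ),
        IsAdmissibleBiasEstimator 𝓜 P₀ b bhat d → IsAdmissibleBiasEstimator 𝓜 P₀ b bhat' d' →
          ∀ n, 0 < n →
            higherOrderVariance P₀ (normalizedSum ψ)
                (correctedA₂ A₂ (b P₀)) (correctedA₃ A₃ d) n
              = higherOrderVariance P₀ (normalizedSum ψ)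
                (correctedA₂ A₂ (b P₀)) (correctedA₃ A₃ d') n) := by
  obtain ⟨δ, hδ⟩ := exists_unique_isEfficientInfluenceFunction hT hb
  have hψ := toLp_mem_tangentSet_of_isSemiparametricallyEfficient hT hθ hθhat hlin heff
  have hδg := ((hδ δ).2 rfl).2
  have hcov : ∀ {d : 𝒵 → ℝ}, IsGradient 𝓜 P₀ b d →
      ∫ z, ψ z * d z ∂(P₀ : Measure 𝒵) = ∫ z, ψ z * δ z ∂(P₀ : Measure 𝒵) := by
    intro d hd
    have hinner : ∀ {u : 𝒵 → ℝ} (hu : MemLp u 2 (P₀ : Measure 𝒵)),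
        inner ℝ (hu.toLp u) (hlin.memLp.toLp ψ) = ∫ z, ψ z * u z ∂(P₀ : Measure 𝒵) := by
      intro u hu
      rw [L2.inner_def]
      refine integral_congr_ae ?_
      filter_upwards [hu.coeFn_toLp, hlin.memLp.coeFn_toLp] with z h1 h2
      rw [h1, h2]
      simp
    have h := hd.inner_sub_eq_zero hδg hψ
    rw [inner_sub_left, hinner, hinner] at h
    exact sub_eq_zero.1 h
  have hvar : ∀ {bhat : (n : ℕ) → (Fin n → 𝒵) → ℝ} {d : 𝒵 → ℝ},
      IsAdmissibleBiasEstimator 𝓜 P₀ b bhat d → ∀ n, 0 < n →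
        higherOrderVariance P₀ (normalizedSum ψ) (correctedA₂ A₂ (b P₀)) (correctedA₃ A₃ d) n
          = higherOrderVariance P₀ (normalizedSum ψ) A₂ A₃ n
            - 2 * ∫ z, ψ z * δ z ∂(P₀ : Measure 𝒵) := by
    intro bhat d hd n hn
    rw [higherOrderVariance_corrected hlin.memLp hlin.mean_zero hd.linear.memLp hn (hA₂ n hn)
      (hA₁A₃ n hn), hcov hd.gradient]
  exact ⟨δ, hδ, fun bhat d hd => ⟨hexp.biasCorrected hd.linear, hcov hd.gradient, hvar hd⟩,
    fun bhat bhat' d d' hd hd' n hn => by rw [hvar hd n hn, hvar hd' n hn]⟩
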